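/- Let $n\ge 1$ and $q\ge 0$ be integers. A real $n\times n$ matrix $\mathbf A$ is \emph{copositive} if $\mathbf x'\mathbf A\mathbf x\ge 0$ for all $\mathbf x\in\mathbb R^n$ with nonnegative entries, and \emph{completely positive} if $\mathbf A=\mathbf B'\mathbf B$ for some $m\times n$ matrix $\mathbf B$ with nonnegative entries. For $n$-dimensional random vectors, write $\boldsymbol Y_1\le_{cop}\boldsymbol Y_2$ if $Ef(\boldsymbol Y_1)\le Ef(\boldsymbol Y_2)$ for every twice continuously differentiable $f:\mathbb R^n\to\mathbb R$ whose Hessian matrix is copositive at every point and for which both expectations exist (that is, $f(\boldsymbol Y_1)$ and $f(\boldsymbol Y_2)$ are integrable). Let $\boldsymbol Z$ be a $q$-dimensional random vector with distribution $H$, let $\alpha,\beta:\mathbb R^q\to[0,\infty)$ be measurable, let $\psi:\mathbb R\to\mathbb R$ with $\psi(0)=1$, and let $g\ge 0$ be a measurable function with $0<\int_0^\infty z^{n/2-1}g(z)\,dz<\infty$. For $\boldsymbol\mu,\boldsymbol\delta\in\mathbb R^n$ and a positive definite matrix $\boldsymbol\Sigma$, a random vector $\boldsymbol Y$ is said to have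 the distribution $LSE_n(\boldsymbol\mu,\boldsymbol\Sigma,\boldsymbol\delta,g,\alpha,\beta,H)$ (location-scale mixture of elliptical distributions) if $$\boldsymbol Y\overset{d}{=}\boldsymbol\mu+\alpha(\boldsymbol Z)\boldsymbol X+\beta(\boldsymbol Z)\boldsymbol\delta ,$$ where $\boldsymbol X$ is independent of $\boldsymbol Z$, has characteristic function $\mathbf t\mapsto\psi(\mathbf t'\boldsymbol\Sigma\mathbf t)$, and has density $$\mathbf x\mapsto\frac{c_n}{\sqrt{|\boldsymbol\Sigma|}}\,g(\mathbf x'\boldsymbol\Sigma^{-1}\mathbf x),\qquad c_n=\frac{\Gamma(n/2)}{\pi^{n/2}}\Big(\int_0^\infty z^{n/2-1}g(z)\,dz\Big)^{-1}.$$ Let $\boldsymbol Y_i\sim LSE_n(\boldsymbol\mu_i,\boldsymbol\Sigma_i,\boldsymbol\delta_i,g,\alpha,\beta,H)$, $i=1,2$, with the same $\psi,g,\alpha,\beta,H$. \begin{enumerate} \item If $\boldsymbol\mu_1=\boldsymbol\mu_2$, $\boldsymbol\delta_1=\boldsymbol\delta_2$ and $\boldsymbol\Sigma_2-\boldsymbol\Sigma_1$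 is completely positive, then $\boldsymbol Y_1\le_{cop}\boldsymbol Y_2$. \end{enumerate} Assume in addition that $\boldsymbol Y_1$ and $\boldsymbol Y_2$ have finite second moments and that $\alpha(\boldsymbol Z)$ is not almost surely $0$. \begin{enumerate} \setcounter{enumi}{1} \item If $\boldsymbol\mu_1=\boldsymbol\mu_2$ and $\beta(\boldsymbol Z)$ is not almost surely $0$, then $\boldsymbol Y_1\le_{cop}\boldsymbol Y_2$ if and only if $\boldsymbol\delta_1=\boldsymbol\delta_2$ and $\boldsymbol\Sigma_2-\boldsymbol\Sigma_1$ is completely positive. \item If $\boldsymbol\delta_1=\boldsymbol\delta_2$, then $\boldsymbol Y_1\le_{cop}\boldsymbol Y_2$ if and only if $\boldsymbol\mu_1=\boldsymbol\mu_2$ and $\boldsymbol\Sigma_2-\boldsymbol\Sigma_1$ is completely positive. \end{enumerate} -/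

import Mathlib

open MeasureTheory

/-- A real square matrix `A` is copositive if `xᵀ A x ≥ 0` for every entrywise nonnegative `x`. -/
def IsCopositive {n : ℕ} (A : Matrix (Fin n) (Fin n) ℝ) : Prop :=
  ∀ x : Fin n → ℝ, (∀ i, 0 ≤ x i) → 0 ≤ dotProduct x (A.mulVec x)

/-- A real square matrix `A` is completely positive if `A = Bᵀ B` for some entrywise nonnegative
`m × n` matrix `B`. -/
def IsCompletelyPositive {n : ℕ} (A : Matrix (Fin n) (Fin n) ℝ) : Prop :=
  ∃ (m : ℕ) (B : Matrix (Fin m) (Fin n) ℝ), (∀ i j, 0 ≤ B i j) ∧ A = B.transpose * B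

/-- The Hessian matrix of `f` at `x`, with entries `∂² f / ∂xᵢ ∂xⱼ`. -/
noncomputable def hessianMatrix {n : ℕ} (f : EuclideanSpace ℝ (Fin n) → ℝ)
    (x : EuclideanSpace ℝ (Fin n)) : Matrix (Fin n) (Fin n) ℝ :=
  Matrix.of fun i j =>
    fderiv ℝ (fun y => fderiv ℝ f y (EuclideanSpace.single j 1)) x (EuclideanSpace.single i 1)

/-- The completely positive order `Y₁ ≤_cop Y₂`: `E f(Y₁) ≤ E f(Y₂)` for every twice continuously
differentiable `f` whose Hessian is copositive at every point and for which both expectations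
exist. -/
def CopOrder {n : ℕ} {Ω₁ Ω₂ : Type*} [MeasurableSpace Ω₁] [MeasurableSpace Ω₂]
    (P₁ : Measure Ω₁) (P₂ : Measure Ω₂)
    (Y₁ : Ω₁ → EuclideanSpace ℝ (Fin n)) (Y₂ : Ω₂ → EuclideanSpace ℝ (Fin n)) : Prop :=
  ∀ f : EuclideanSpace ℝ (Fin n) → ℝ, ContDiff ℝ 2 f → (∀ x, IsCopositive (hessianMatrix f x)) →
    Integrable (fun ω => f (Y₁ ω)) P₁ → Integrable (fun ω => f (Y₂ ω)) P₂ →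
    ∫ ω, f (Y₁ ω) ∂P₁ ≤ ∫ ω, f (Y₂ ω) ∂P₂

/-- The quadratic form `xᵀ S x`. -/
noncomputable def matQuadForm {n : ℕ} (S : Matrix (Fin n) (Fin n) ℝ)
    (x : EuclideanSpace ℝ (Fin n)) : ℝ :=
  dotProduct x.ofLp (S.mulVec x.ofLp)

/-- `ν` is the elliptical law `ELL_n(m, S, ψ)`: its characteristic function is
`t ↦ exp(i tᵀ m) ψ(tᵀ S t)`, where `ψ(0) = 1`. -/
def IsElliptical {n : ℕ} (ν : Measure (EuclideanSpace ℝ (Fin n))) (m : EuclideanSpace ℝ (Fin n))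
    (S : Matrix (Fin n) (Fin n) ℝ) (ψ : ℝ → ℝ) : Prop :=
  ψ 0 = 1 ∧ ∀ t : EuclideanSpace ℝ (Fin n),
    charFun ν t = Complex.exp (Complex.I * (inner ℝ t m : ℝ)) * (ψ (matQuadForm S t) : ℂ)

/-- The integral `∫₀^∞ z^(n/2-1) g(z) dz`. -/
noncomputable def generatorIntegral (n : ℕ) (g : ℝ → ℝ) : ℝ :=
  ∫ z in Set.Ioi (0 : ℝ), z ^ ((n : ℝ) / 2 - 1) * g z

/-- The normalizing constant `c_n = Γ(n/2) / π^(n/2) · (∫₀^∞ z^(n/2-1) g(z) dz)⁻¹`. -/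
noncomputable def normalizingConst (n : ℕ) (g : ℝ → ℝ) : ℝ :=
  Real.Gamma ((n : ℝ) / 2) / Real.pi ^ ((n : ℝ) / 2) * (generatorIntegral n g)⁻¹

/-- `ν` has the elliptical density `x ↦ c_n |S|^(-1/2) g((x - m)ᵀ S⁻¹ (x - m))` with density
generator `g`, a nonnegative function with `0 < ∫₀^∞ z^(n/2-1) g(z) dz < ∞`. -/
structure HasDensityGenerator {n : ℕ} (ν : Measure (EuclideanSpace ℝ (Fin n)))
    (m : EuclideanSpace ℝ (Fin n)) (S : Matrix (Fin n) (Fin n) ℝ) (g : ℝ → ℝ) : Prop where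
  measurable : Measurable g
  nonneg : ∀ u, 0 ≤ u → 0 ≤ g u
  integrable : IntegrableOn (fun z : ℝ => z ^ ((n : ℝ) / 2 - 1) * g z) (Set.Ioi 0)
  pos : 0 < generatorIntegral n g
  density : ν = volume.withDensity fun x =>
    ENNReal.ofReal (normalizingConst n g / Real.sqrt S.det * g (matQuadForm S⁻¹ (x - m)))

/-- The random vector `Y` has the location-scale mixture of elliptical distributions
`LSE_n(μ, S, δ, ψ, α, β, H)` with density generator `g`: `Y` is equal in distribution to
`μ + α(Z) X + β(Z) δ`, where `X ∼ ELL_n(0, S, ψ)` has density generator `g`, `S` is positive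
definite, `Z` has law `H` and is independent of `X` (so that `(X, Z)` has a product law), and
`α, β` are nonnegative measurable functions. -/
structure IsLSE {n q : ℕ} {Ω : Type*} [MeasurableSpace Ω] (P : Measure Ω)
    (Y : Ω → EuclideanSpace ℝ (Fin n)) (μ : EuclideanSpace ℝ (Fin n))
    (S : Matrix (Fin n) (Fin n) ℝ) (δ : EuclideanSpace ℝ (Fin n)) (ψ g : ℝ → ℝ)
    (α β : EuclideanSpace ℝ (Fin q) → ℝ) (H : Measure (EuclideanSpace ℝ (Fin q))) : Prop where
  aemeasurable : AEMeasurable Y P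
  posDef : S.PosDef
  measurable_scale : Measurable α
  scale_nonneg : ∀ z, 0 ≤ α z
  measurable_loc : Measurable β
  loc_nonneg : ∀ z, 0 ≤ β z
  law : ∃ ν : Measure (EuclideanSpace ℝ (Fin n)), IsProbabilityMeasure ν ∧
    IsElliptical ν 0 S ψ ∧ HasDensityGenerator ν 0 S g ∧
    P.map Y = (ν.prod H).map fun p => μ + α p.2 • p.1 + β p.2 • δ

/-! Sufficiency: a copositive Hessian makes `f` convex along every nonnegative direction. A
completely positive difference is a sum of terms bb' with b ≥ 0, so it is enough to pass from S to S
+ bb'. Put w = S⁻¹b and s = w'b. The map M = 1 + t bw', for a suitable t, carries the elliptical law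
of scale S to that of scale S + bb', and the reflection ρ = 1 - (2/s) bw' preserves the former. On
each line parallel to b, ρ flips the sign of a coordinate that M stretches by √(1+s) ≥ 1.
One-dimensional convexity compares the ρ-symmetrised values of `f` and `f ∘ M`, and integrating
gives the inequality (`integral_ellipticalLaw_le_add_vecMulVec`). Mixing over Z keeps it, since the
scale is nonnegative. Only `f(Y₁)` and `f(Y₂)` are known to be integrable, so all this is done for
truncated generators, with a limit at the end.

Necessity: testing with ± linear functionals equates the means. Testing with x'Ax for copositive A,
and using that the centred part of Y has second moment matrix a positive multiple of S, gives ⟨A, S₂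
- S₁⟩ ≥ 0. The completely positive cone is dual to the copositive cone
(`isCompletelyPositive_of_dual`), which concludes. -/

/-- `f` is convex along every line with entrywise nonnegative direction. -/
def ConvexAlongNonneg {n : ℕ} (f : EuclideanSpace ℝ (Fin n) → ℝ) : Prop :=
  ∀ x b : EuclideanSpace ℝ (Fin n), (∀ i, 0 ≤ b i) →
    ConvexOn ℝ Set.univ fun t : ℝ => f (x + t • b)

/-! ### Copositive Hessians and test functions -/

theorem hessianMatrix_dotProduct {n : ℕ} {f : EuclideanSpace ℝ (Fin n) → ℝ}
    (hf : ContDiff ℝ 2 f) (x b : EuclideanSpace ℝ (Fin n)) :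
    dotProduct b.ofLp ((hessianMatrix f x).mulVec b.ofLp) =
      fderiv ℝ (fderiv ℝ f) x b b := by
  have hd : Differentiable ℝ (fderiv ℝ f) :=
    (hf.fderiv_right (m := 1) (by norm_num)).differentiable (by norm_num)
  have he : ∀ i j, hessianMatrix f x i j =
      fderiv ℝ (fderiv ℝ f) x (EuclideanSpace.single i 1) (EuclideanSpace.single j 1) := by
    intro i j
    simp only [hessianMatrix, Matrix.of_apply]
    rw [fderiv_clm_apply hd.differentiableAt (differentiableAt_const _)]
    simp
  have hb : b = ∑ i, b i • EuclideanSpace.single i (1 : ℝ) := by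
    ext k
    simp [Pi.single_apply]
  conv_rhs => rw [hb]
  simp only [map_sum, map_smul, _root_.sum_apply, _root_.smul_apply,
    smul_eq_mul, dotProduct, Matrix.mulVec, he, Finset.mul_sum]
  rw [Finset.sum_comm]
  refine Finset.sum_congr rfl fun i _ => Finset.sum_congr rfl fun j _ => ?_
  ring

theorem convexAlongNonneg_of_isCopositive {n : ℕ} {f : EuclideanSpace ℝ (Fin n) → ℝ}
    (hf : ContDiff ℝ 2 f) (hc : ∀ x, IsCopositive (hessianMatrix f x)) :
    ConvexAlongNonneg f := by
  intro x b hb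
  have hd : Differentiable ℝ (fderiv ℝ f) :=
    (hf.fderiv_right (m := 1) (by norm_num)).differentiable (by norm_num)
  have hd0 : Differentiable ℝ f := hf.differentiable (by norm_num)
  have hl : ∀ t : ℝ, HasDerivAt (fun t : ℝ => x + t • b) b t := fun t => by
    simpa using ((hasDerivAt_id t).smul_const b).const_add x
  have h1 : ∀ t : ℝ, HasDerivAt (fun t : ℝ => f (x + t • b)) (fderiv ℝ f (x + t • b) b) t :=
    fun t => (hd0 _).hasFDerivAt.comp_hasDerivAt t (hl t)
  have h2 : ∀ t : ℝ, HasDerivAt (fun t : ℝ => fderiv ℝ f (x + t • b) b)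
      (fderiv ℝ (fderiv ℝ f) (x + t • b) b b) t := fun t => by
    have := ((hd _).hasFDerivAt.comp_hasDerivAt t (hl t)).clm_apply (hasDerivAt_const t b)
    simpa using this
  have hderiv : deriv (fun t : ℝ => f (x + t • b)) = fun t => fderiv ℝ f (x + t • b) b :=
    funext fun t => (h1 t).deriv
  refine convexOn_univ_of_deriv2_nonneg (fun t => (h1 t).differentiableAt) ?_ ?_
  · rw [hderiv]; exact fun t => (h2 t).differentiableAt
  · intro t
    simp only [Function.iterate_succ, Function.iterate_zero, Function.comp_apply, id]
    rw [hderiv, (h2 t).deriv, ← hessianMatrix_dotProduct hf]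
    exact hc _ _ hb

theorem hessianMatrix_continuousLinearMap {n : ℕ} (l : EuclideanSpace ℝ (Fin n) →L[ℝ] ℝ)
    (x : EuclideanSpace ℝ (Fin n)) : hessianMatrix l x = 0 := by
  ext i j
  simp [hessianMatrix]

theorem contDiff_matQuadForm {n : ℕ} (A : Matrix (Fin n) (Fin n) ℝ) :
    ContDiff ℝ 2 (matQuadForm A) := by
  unfold matQuadForm
  simp only [dotProduct, Matrix.mulVec]
  fun_prop

theorem matQuadForm_add_smul {n : ℕ} (A : Matrix (Fin n) (Fin n) ℝ)
    (x b : EuclideanSpace ℝ (Fin n)) (t : ℝ) :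
    matQuadForm A (x + t • b) = matQuadForm A x +
      t * (dotProduct x.ofLp (A.mulVec b.ofLp) + dotProduct b.ofLp (A.mulVec x.ofLp)) +
      t ^ 2 * matQuadForm A b := by
  simp only [matQuadForm, WithLp.ofLp_add, WithLp.ofLp_smul, Matrix.mulVec_add, Matrix.mulVec_smul,
    dotProduct_add, add_dotProduct, smul_dotProduct, dotProduct_smul, smul_eq_mul]
  ring

/-- `A` need not be symmetric: the Hessian is A + A', whose quadratic form is twice that of `A`. It
is read off from the second derivative along x + tb. -/
theorem isCopositive_hessianMatrix_matQuadForm {n : ℕ} {A : Matrix (Fin n) (Fin n) ℝ}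
    (hA : IsCopositive A) (x : EuclideanSpace ℝ (Fin n)) :
    IsCopositive (hessianMatrix (matQuadForm A) x) := by
  intro v hv
  have hf := contDiff_matQuadForm A
  set b : EuclideanSpace ℝ (Fin n) := WithLp.toLp 2 v with hb
  have key := hessianMatrix_dotProduct hf x b
  have hd : Differentiable ℝ (fderiv ℝ (matQuadForm A)) :=
    (hf.fderiv_right (m := 1) (by norm_num)).differentiable (by norm_num)
  have hd0 : Differentiable ℝ (matQuadForm A) := hf.differentiable (by norm_num)
  have hl : ∀ t : ℝ, HasDerivAt (fun t : ℝ => x + t • b) b t := fun t => by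
    simpa using ((hasDerivAt_id t).smul_const b).const_add x
  have h1 : ∀ t : ℝ, fderiv ℝ (matQuadForm A) (x + t • b) b =
      dotProduct x.ofLp (A.mulVec b.ofLp) + dotProduct b.ofLp (A.mulVec x.ofLp) +
        t * (2 * matQuadForm A b) := fun t => by
    have e1 := (hd0 _).hasFDerivAt.comp_hasDerivAt t (hl t)
    refine e1.unique ?_
    have e2 : (matQuadForm A ∘ fun t : ℝ => x + t • b) = fun t => matQuadForm A x +
      t * (dotProduct x.ofLp (A.mulVec b.ofLp) + dotProduct b.ofLp (A.mulVec x.ofLp)) +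
      t ^ 2 * matQuadForm A b := funext fun t => matQuadForm_add_smul A x b t
    rw [e2]
    have := (((hasDerivAt_id t).mul_const (dotProduct x.ofLp (A.mulVec b.ofLp) +
      dotProduct b.ofLp (A.mulVec x.ofLp))).const_add (matQuadForm A x)).add
      ((hasDerivAt_pow 2 t).mul_const (matQuadForm A b))
    refine this.congr_deriv ?_
    simp; ring
  have h2 : fderiv ℝ (fderiv ℝ (matQuadForm A)) x b b = 2 * matQuadForm A b := by
    have e := ((hd _).hasFDerivAt.comp_hasDerivAt (0 : ℝ) (hl 0)).clm_apply (hasDerivAt_const 0 b)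
    have e' : HasDerivAt (fun t : ℝ => fderiv ℝ (matQuadForm A) (x + t • b) b)
        (2 * matQuadForm A b) 0 := by
      rw [funext h1]
      simpa using ((hasDerivAt_id (0 : ℝ)).mul_const (2 * matQuadForm A b)).const_add
        (dotProduct x.ofLp (A.mulVec b.ofLp) + dotProduct b.ofLp (A.mulVec x.ofLp))
    have := e.unique e'
    simpa using this
  rw [h2] at key
  have : 0 ≤ matQuadForm A b := hA v hv
  simp only [hb] at key this
  rw [key]
  positivity

/-! ### Duality of the copositive and completely positive cones -/

/-- By Carathéodory, at most dim E + 1 points are needed, so the hull is a finite union of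
continuous images of compact sets (simplex times powers of `s`). -/
theorem isCompact_convexHull_of_isCompact {E : Type*} [NormedAddCommGroup E] [NormedSpace ℝ E]
    [FiniteDimensional ℝ E] {s : Set E} (hs : IsCompact s) : IsCompact (convexHull ℝ s) := by
  set N := Module.finrank ℝ E + 1
  let T : (k : ℕ) → Set E := fun k =>
    (fun p : (Fin k → ℝ) × (Fin k → E) => ∑ i, p.1 i • p.2 i) ''
      (stdSimplex ℝ (Fin k) ×ˢ Set.pi Set.univ fun _ => s)
  have hT : ∀ k, IsCompact (T k) := fun k => by
    refine ((isCompact_stdSimplex ℝ (Fin k)).prod (isCompact_univ_pi fun _ => hs)).image ?_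
    fun_prop
  have hU : convexHull ℝ s = ⋃ k ∈ Finset.range (N + 1), T k := by
    apply Set.Subset.antisymm
    · intro x hx
      obtain ⟨ι, _, z, w, hz, ha, hw, hw1, hx⟩ := eq_pos_convex_span_of_mem_convexHull hx
      have hc : Fintype.card ι ≤ N :=
        ha.card_le_finrank_succ.trans (Nat.succ_le_succ (Submodule.finrank_le _))
      refine Set.mem_iUnion₂.2 ⟨Fintype.card ι, by simpa [Nat.lt_succ_iff] using hc, ?_⟩
      let e := (Fintype.equivFin ι).symm
      refine ⟨(w ∘ e, z ∘ e), ⟨⟨fun i => (hw _).le, ?_⟩, fun i _ => hz ⟨_, rfl⟩⟩, ?_⟩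
      · rw [← hw1]; exact e.sum_comp w
      · rw [← hx]; exact e.sum_comp fun i => w i • z i
    · refine Set.iUnion₂_subset fun k _ => ?_
      rintro _ ⟨⟨w, z⟩, ⟨⟨hw, hw1⟩, hz⟩, rfl⟩
      exact (convex_convexHull ℝ s).sum_mem (fun i _ => hw i) hw1
        fun i _ => subset_convexHull ℝ s (hz i trivial)
  rw [hU]
  exact (Finset.range (N + 1)).isCompact_biUnion fun k _ => hT k

theorem isCompletelyPositive_zero {n : ℕ} :
    IsCompletelyPositive (0 : Matrix (Fin n) (Fin n) ℝ) :=
  ⟨0, 0, fun _ _ => le_rfl, by simp⟩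

theorem isCompletelyPositive_sum_vecMulVec {n k : ℕ} {w : Fin k → ℝ} (hw : ∀ i, 0 ≤ w i)
    {b : Fin k → Fin n → ℝ} (hb : ∀ i j, 0 ≤ b i j) :
    IsCompletelyPositive (∑ i, w i • Matrix.vecMulVec (b i) (b i)) := by
  refine ⟨k, Matrix.of fun i j => √(w i) * b i j, fun i j => ?_, ?_⟩
  · exact mul_nonneg (Real.sqrt_nonneg _) (hb i j)
  · ext p r
    simp only [Matrix.sum_apply, Matrix.smul_apply, Matrix.vecMulVec_apply, smul_eq_mul,
      Matrix.mul_apply, Matrix.transpose_apply, Matrix.of_apply]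
    refine Finset.sum_congr rfl fun i _ => ?_
    nth_rewrite 1 [← Real.mul_self_sqrt (hw i)]
    ring

theorem sum_mul_mul_eq_dotProduct {n : ℕ} (A : Matrix (Fin n) (Fin n) ℝ) (x : Fin n → ℝ) :
    dotProduct x (A.mulVec x) = ∑ i, ∑ j, A i j * (x i * x j) := by
  simp only [dotProduct, Matrix.mulVec, Finset.mul_sum]
  refine Finset.sum_congr rfl fun i _ => Finset.sum_congr rfl fun j _ => ?_
  ring

/-- For |c| ≤ 1 the identity plus c in position (p, r) is copositive, because x_p x_r ≤ Σ x_i². With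
zero trace, c = ±1 kills each entry of `C`. -/
theorem eq_zero_of_dual_of_trace_eq_zero {n : ℕ} {C : Matrix (Fin n) (Fin n) ℝ}
    (hC : ∀ A : Matrix (Fin n) (Fin n) ℝ, IsCopositive A → 0 ≤ ∑ i, ∑ j, A i j * C i j)
    (h0 : ∑ i, C i i = 0) : C = 0 := by
  have hone : ∀ c : ℝ, |c| ≤ 1 → ∀ p r, 0 ≤ c * C p r := by
    intro c hc p r
    have := hC (Matrix.of fun i j => (if i = j then 1 else 0) +
      (if i = p then (if j = r then c else 0) else 0)) ?_
    · simpa [add_mul, Finset.sum_add_distrib, h0] using this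
    · intro x hx
      rw [sum_mul_mul_eq_dotProduct]
      simp only [Matrix.of_apply, add_mul, Finset.sum_add_distrib, ite_mul, zero_mul, one_mul,
        Finset.sum_ite_eq, Finset.mem_univ, if_true, Finset.sum_ite_eq', Finset.sum_ite_irrel,
        Finset.sum_const_zero]
      have h1 : x p * x p ≤ ∑ i, x i * x i :=
        Finset.single_le_sum (f := fun i => x i * x i) (fun i _ => mul_self_nonneg _)
          (Finset.mem_univ p)
      have h2 : x r * x r ≤ ∑ i, x i * x i :=
        Finset.single_le_sum (f := fun i => x i * x i) (fun i _ => mul_self_nonneg _)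
          (Finset.mem_univ r)
      have h3 : x p * x r ≤ ∑ i, x i * x i := by nlinarith [sq_nonneg (x p - x r)]
      have h4 : -(x p * x r) ≤ c * (x p * x r) := by
        nlinarith [mul_nonneg (hx p) (hx r), (abs_le.1 hc).1]
      linarith
  ext p r
  have h1 := hone 1 (by simp) p r
  have h2 := hone (-1) (by simp) p r
  simp only [Matrix.zero_apply]
  linarith

/-- After scaling to trace 1, `C` is compared with the compact convex hull of the bb', b a
nonnegative unit vector. If it lay outside, a separating functional would yield a copositive matrix
violating the hypothesis. Symmetry of `C` is a consequence, as non-symmetric `A` are allowed as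
tests. -/
theorem isCompletelyPositive_of_dual {n : ℕ} {C : Matrix (Fin n) (Fin n) ℝ}
    (hC : ∀ A : Matrix (Fin n) (Fin n) ℝ, IsCopositive A → 0 ≤ ∑ i, ∑ j, A i j * C i j) :
    IsCompletelyPositive C := by
  have htr : 0 ≤ ∑ i, C i i := by
    have := hC 1 fun x hx => by
      simpa [dotProduct] using Finset.sum_nonneg fun i _ => mul_self_nonneg (x i)
    simpa [Matrix.one_apply] using this
  rcases htr.eq_or_lt with h0 | hpos
  · rw [eq_zero_of_dual_of_trace_eq_zero hC h0.symm]
    exact isCompletelyPositive_zero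
  set c := ∑ i, C i i with hc
  let D : Set (Fin n → ℝ) := {b | (∀ i, 0 ≤ b i) ∧ ∑ i, b i * b i = 1}
  have hD : IsCompact D := by
    refine Metric.isCompact_of_isClosed_isBounded ?_ ?_
    · have hDe : D = (⋂ i, {b | 0 ≤ b i}) ∩ {b | ∑ i, b i * b i = 1} := by
        ext b
        simp [D]
      rw [hDe]
      refine IsClosed.inter ?_ ?_
      · exact isClosed_iInter fun i => isClosed_le continuous_const (continuous_apply i)
      · exact isClosed_eq (by fun_prop) continuous_const
    · refine (Metric.isBounded_Icc (0 : Fin n → ℝ) 1).subset fun b hb => ⟨hb.1, fun i => ?_⟩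
      have h1 : b i * b i ≤ 1 := hb.2 ▸
        Finset.single_le_sum (f := fun i => b i * b i) (fun i _ => mul_self_nonneg _)
          (Finset.mem_univ i)
      show b i ≤ 1
      nlinarith [hb.1 i]
  let K : Set (Fin n → Fin n → ℝ) := (fun b i j => b i * b j) '' D
  have hK : IsCompact K := hD.image (by fun_prop)
  have hKc := isCompact_convexHull_of_isCompact hK
  let x : Fin n → Fin n → ℝ := fun i j => c⁻¹ * C i j
  by_cases hx : x ∈ convexHull ℝ K
  · obtain ⟨ι, _, z, w, hz, -, hw, -, hs⟩ := eq_pos_convex_span_of_mem_convexHull hx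
    let e := (Fintype.equivFin ι).symm
    have hz' : ∀ i, ∃ b ∈ D, (fun p r => b p * b r) = z i := fun i => hz ⟨i, rfl⟩
    choose b hbD hbz using hz'
    have : C = ∑ i, (c * w (e i)) • Matrix.vecMulVec (b (e i)) (b (e i)) := by
      rw [e.sum_comp fun i => (c * w i) • Matrix.vecMulVec (b i) (b i)]
      ext p r
      have h1 : ∑ i, w i * (b i p * b i r) = c⁻¹ * C p r := by
        have := congrFun (congrFun hs p) r
        simp only [← hbz, Finset.sum_apply, Pi.smul_apply, smul_eq_mul] at this
        exact this
      simp only [Matrix.sum_apply, Matrix.smul_apply, Matrix.vecMulVec_apply, smul_eq_mul,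
        mul_assoc, ← Finset.mul_sum, h1]
      field_simp
    rw [this]
    exact isCompletelyPositive_sum_vecMulVec (fun i => mul_nonneg hpos.le (hw _).le)
      fun i => (hbD _).1
  · exfalso
    obtain ⟨l, u, hlu, hl⟩ := geometric_hahn_banach_point_closed (convex_convexHull ℝ K)
      hKc.isClosed hx
    let a : Matrix (Fin n) (Fin n) ℝ := fun i j => l (Pi.single i (Pi.single j 1))
    have hla : ∀ y : Fin n → Fin n → ℝ, l y = ∑ i, ∑ j, a i j * y i j := by
      intro y
      have hy : y = ∑ i, ∑ j, y i j • (Pi.single i (Pi.single j 1) : Fin n → Fin n → ℝ) := by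
        ext p r
        simp [Finset.sum_apply, Pi.single_apply, ite_apply]
      conv_lhs => rw [hy]
      simp only [map_sum, map_smul, smul_eq_mul, a]
      refine Finset.sum_congr rfl fun i _ => Finset.sum_congr rfl fun j _ => mul_comm _ _
    -- The threshold `u` is absorbed as u times the trace, which is 1 on `K`; this turns the
    -- separation into a homogeneous inequality.
    have hsub : ∀ y : Fin n → Fin n → ℝ, ∑ i, ∑ j, (a - u • (1 : Matrix (Fin n) (Fin n) ℝ)) i j * y i j =
        l y - u * ∑ i, y i i := by
      intro y
      simp [hla, sub_mul, Finset.sum_sub_distrib, Matrix.one_apply, Finset.mul_sum]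
    have hneg := hC (a - u • 1) ?_
    · rw [hsub C, ← hc] at hneg
      have hxl : l x = c⁻¹ * l C := by
        exact map_smul l c⁻¹ (show Fin n → Fin n → ℝ from C)
      rw [hxl] at hlu
      have : l C < c * u := by
        rwa [inv_mul_lt_iff₀ hpos] at hlu
      linarith
    · intro v hv
      rw [sum_mul_mul_eq_dotProduct, hsub fun i j => v i * v j]
      set s := ∑ i, v i * v i with hs
      have hs0 : 0 ≤ s := Finset.sum_nonneg fun i _ => mul_self_nonneg _
      rcases hs0.eq_or_lt with h | h
      · have hv0 : ∀ i, v i = 0 := fun i => by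
          have := (Finset.sum_eq_zero_iff_of_nonneg fun i _ => mul_self_nonneg (v i)).1 h.symm i
            (Finset.mem_univ i)
          exact mul_self_eq_zero.1 this
        have : (fun i j => v i * v j) = (0 : Fin n → Fin n → ℝ) := by
          ext i j; simp only [hv0, mul_zero]; rfl
        rw [this]; simp [← h]
      · have hm : (fun i j => (v i / √s) * (v j / √s)) ∈ K := by
          refine ⟨fun i => v i / √s, ⟨fun i => div_nonneg (hv i) (Real.sqrt_nonneg _), ?_⟩, rfl⟩
          simp only [div_mul_div_comm, Real.mul_self_sqrt hs0, ← Finset.sum_div]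
          exact div_self h.ne'
        have h1 := hl _ (subset_convexHull ℝ K hm)
        have h2 : (fun i j => (v i / √s) * (v j / √s)) = s⁻¹ • (fun i j => v i * v j : Fin n → Fin n → ℝ) := by
          ext i j
          simp only [Pi.smul_apply, smul_eq_mul, div_mul_div_comm, Real.mul_self_sqrt hs0]
          field_simp
        rw [h2, map_smul, smul_eq_mul, inv_mul_eq_div, lt_div_iff₀ h] at h1
        linarith

/-! ### Elliptical laws under linear maps and truncation -/

/-- The elliptical law centred at `0` with scale matrix `S` and generator `h`, which includes the
normalizing constant and takes values in `[0, ∞]`. -/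
noncomputable def ellipticalLaw {n : ℕ} (S : Matrix (Fin n) (Fin n) ℝ) (h : ℝ → ENNReal) :
    Measure (EuclideanSpace ℝ (Fin n)) :=
  volume.withDensity fun x => ENNReal.ofReal (1 / √S.det) * h (matQuadForm S⁻¹ x)

theorem continuous_matQuadForm {n : ℕ} (A : Matrix (Fin n) (Fin n) ℝ) :
    Continuous (matQuadForm A) :=
  (contDiff_matQuadForm A).continuous

theorem matQuadForm_toEuclideanLin {n : ℕ} (A M : Matrix (Fin n) (Fin n) ℝ)
    (x : EuclideanSpace ℝ (Fin n)) :
    matQuadForm A (Matrix.toEuclideanLin M x) = matQuadForm (M.transpose * A * M) x := by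
  simp only [matQuadForm, Matrix.ofLp_toLpLin, Matrix.toLin'_apply]
  rw [← Matrix.mulVec_mulVec, ← Matrix.mulVec_mulVec, Matrix.dotProduct_mulVec x.ofLp,
    Matrix.vecMul_transpose]

theorem det_toEuclideanLin {n : ℕ} (M : Matrix (Fin n) (Fin n) ℝ) :
    LinearMap.det (Matrix.toEuclideanLin M) = M.det := by
  rw [Matrix.toEuclideanLin_eq_toLin_orthonormal, LinearMap.det_toLin]

theorem continuous_toEuclideanLin {n : ℕ} (M : Matrix (Fin n) (Fin n) ℝ) :
    Continuous (Matrix.toEuclideanLin M) :=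
  LinearMap.continuous_of_finiteDimensional _

theorem map_ellipticalLaw {n : ℕ} {S M : Matrix (Fin n) (Fin n) ℝ} {h : ℝ → ENNReal}
    (hh : Measurable h) (hM : M.det ≠ 0) :
    (ellipticalLaw S h).map (Matrix.toEuclideanLin M) =
      ellipticalLaw (M * S * M.transpose) h := by
  have hTm : Measurable (Matrix.toEuclideanLin M) := (continuous_toEuclideanLin M).measurable
  have hinv : M.transpose * (M * S * M.transpose)⁻¹ * M = S⁻¹ := by
    have hu : IsUnit M.det := hM.isUnit
    have hut : IsUnit M.transpose.det := by rwa [Matrix.det_transpose]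
    rw [Matrix.mul_inv_rev, Matrix.mul_inv_rev, ← Matrix.mul_assoc, ← Matrix.mul_assoc,
      Matrix.mul_nonsing_inv _ hut, Matrix.one_mul, Matrix.mul_assoc,
      Matrix.nonsing_inv_mul _ hu, Matrix.mul_one]
  have hmeas : Measurable fun y => h (matQuadForm (M * S * M.transpose)⁻¹ y) :=
    hh.comp (continuous_matQuadForm _).measurable
  have hconst : ENNReal.ofReal (1 / √S.det) * ENNReal.ofReal |M.det⁻¹| =
      ENNReal.ofReal (1 / √(M * S * M.transpose).det) := by
    rw [← ENNReal.ofReal_mul (by positivity), Matrix.det_mul, Matrix.det_mul,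
      Matrix.det_transpose, show M.det * S.det * M.det = M.det ^ 2 * S.det by ring,
      Real.sqrt_mul (sq_nonneg _), Real.sqrt_sq_eq_abs, abs_inv, ← one_div, div_mul_div_comm,
      one_mul, mul_comm |M.det|]
  ext s hs
  rw [Measure.map_apply hTm hs, ellipticalLaw, ellipticalLaw, withDensity_apply _ (hTm hs),
    withDensity_apply _ hs, lintegral_const_mul' _ _ ENNReal.ofReal_ne_top,
    lintegral_const_mul' _ _ ENNReal.ofReal_ne_top, ← hconst, mul_assoc]
  congr 1
  have h1 := setLIntegral_map (μ := volume) hs hmeas hTm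
  rw [Measure.map_linearMap_addHaar_eq_smul_addHaar volume
    (by rwa [det_toEuclideanLin] : LinearMap.det (Matrix.toEuclideanLin M) ≠ 0),
    det_toEuclideanLin, Measure.restrict_smul, lintegral_smul_measure, smul_eq_mul] at h1
  rw [h1]
  simp only [matQuadForm_toEuclideanLin, hinv]

open scoped MatrixOrder Matrix.Norms.L2Operator in
/-- A positive definite real matrix is `L Lᵀ` with `L` invertible. -/
theorem exists_eq_mul_transpose {n : ℕ} {S : Matrix (Fin n) (Fin n) ℝ} (hS : S.PosDef) :
    ∃ L : Matrix (Fin n) (Fin n) ℝ, L.det ≠ 0 ∧ S = L * L.transpose := by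
  obtain ⟨B, rfl⟩ := CStarAlgebra.nonneg_iff_eq_star_mul_self.mp hS.posSemidef.nonneg
  have hst : star B = B.transpose := by
    rw [Matrix.star_eq_conjTranspose, Matrix.conjTranspose_eq_transpose_of_trivial]
  refine ⟨B.transpose, fun h0 => hS.det_pos.ne' ?_, by rw [hst, Matrix.transpose_transpose]⟩
  rw [hst, Matrix.det_mul, h0, zero_mul]

theorem ellipticalLaw_eq_map_one {n : ℕ} {L : Matrix (Fin n) (Fin n) ℝ} {h : ℝ → ENNReal}
    (hh : Measurable h) (hL : L.det ≠ 0) :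
    ellipticalLaw (L * L.transpose) h =
      (ellipticalLaw 1 h).map (Matrix.toEuclideanLin L) := by
  rw [map_ellipticalLaw hh hL, Matrix.mul_one]

/-- The total mass of an elliptical law does not depend on the scale matrix. -/
theorem ellipticalLaw_univ {n : ℕ} {S : Matrix (Fin n) (Fin n) ℝ} {h : ℝ → ENNReal}
    (hh : Measurable h) (hS : S.PosDef) :
    ellipticalLaw S h Set.univ =
      ellipticalLaw (1 : Matrix (Fin n) (Fin n) ℝ) h Set.univ := by
  obtain ⟨L, hL, rfl⟩ := exists_eq_mul_transpose hS
  rw [ellipticalLaw_eq_map_one hh hL,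
    Measure.map_apply (continuous_toEuclideanLin L).measurable MeasurableSet.univ, Set.preimage_univ]

/-- Cutting the law off at an ellipsoid amounts to cutting off the generator, so truncated laws are
again elliptical and transform in the same way under linear maps. -/
theorem ellipticalLaw_indicator {n : ℕ} (S : Matrix (Fin n) (Fin n) ℝ) (h : ℝ → ENNReal) (R : ℝ) :
    ellipticalLaw S ((Set.Iic R).indicator h) =
      (ellipticalLaw S h).restrict {x | matQuadForm S⁻¹ x ≤ R} := by
  have hs : MeasurableSet {x | matQuadForm S⁻¹ x ≤ R} :=
    measurableSet_le (continuous_matQuadForm _).measurable measurable_const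
  rw [ellipticalLaw, ellipticalLaw, restrict_withDensity hs, ← withDensity_indicator hs]
  congr 1
  ext x
  by_cases hx : matQuadForm S⁻¹ x ≤ R
  · simp [Set.indicator, hx]
  · simp [Set.indicator, hx]

theorem integrable_ellipticalLaw_indicator {n : ℕ} {S : Matrix (Fin n) (Fin n) ℝ}
    {h : ℝ → ENNReal} (hh : Measurable h) (hS : S.PosDef) 
    [IsFiniteMeasure (ellipticalLaw (1 : Matrix (Fin n) (Fin n) ℝ) h)]
    (R : ℝ) {f : EuclideanSpace ℝ (Fin n) → ℝ} (hf : Continuous f) :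
    Integrable f (ellipticalLaw S ((Set.Iic R).indicator h)) := by
  have hh' : Measurable ((Set.Iic R).indicator h) := hh.indicator measurableSet_Iic
  obtain ⟨L, hL, rfl⟩ := exists_eq_mul_transpose hS
  have hLc := continuous_toEuclideanLin L
  rw [ellipticalLaw_eq_map_one hh' hL, integrable_map_measure hf.aestronglyMeasurable
    hLc.measurable.aemeasurable, ellipticalLaw_indicator]
  have hcomp : IsCompact {x : EuclideanSpace ℝ (Fin n) | matQuadForm 1⁻¹ x ≤ R} := by
    refine Metric.isCompact_of_isClosed_isBounded
      (isClosed_le (continuous_matQuadForm _) continuous_const) ?_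
    refine (Metric.isBounded_closedBall (x := 0) (r := √R)).subset fun x hx => ?_
    have hx' : ‖x‖ ^ 2 ≤ R := by
      rw [EuclideanSpace.real_norm_sq_eq]
      simpa [matQuadForm, dotProduct, sq] using hx
    simpa using Real.le_sqrt_of_sq_le hx'
  exact (hf.comp hLc).continuousOn.integrableOn_compact hcomp

/-! ### Monotonicity under completely positive increments -/

/-- Both a and -a are convex combinations of ±ka, with weights (1 ± k⁻¹)/2 interchanged. -/
theorem ConvexOn.add_neg_le_add_neg_mul {φ : ℝ → ℝ} (hφ : ConvexOn ℝ Set.univ φ) (a : ℝ) {k : ℝ}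
    (hk : 1 ≤ k) : φ a + φ (-a) ≤ φ (k * a) + φ (-(k * a)) := by
  have hk0 : 0 < k := by linarith
  have hki : k⁻¹ ≤ 1 := inv_le_one_of_one_le₀ hk
  have hki0 : 0 < k⁻¹ := inv_pos.2 hk0
  have h1 := hφ.2 (Set.mem_univ (k * a)) (Set.mem_univ (-(k * a)))
    (show 0 ≤ (1 + k⁻¹) / 2 by linarith) (show 0 ≤ (1 - k⁻¹) / 2 by linarith) (by ring)
  have h2 := hφ.2 (Set.mem_univ (-(k * a))) (Set.mem_univ (k * a))
    (show 0 ≤ (1 + k⁻¹) / 2 by linarith) (show 0 ≤ (1 - k⁻¹) / 2 by linarith) (by ring)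
  simp only [smul_eq_mul] at h1 h2
  have e1 : (1 + k⁻¹) / 2 * (k * a) + (1 - k⁻¹) / 2 * -(k * a) = a := by field_simp; ring
  have e2 : (1 + k⁻¹) / 2 * -(k * a) + (1 - k⁻¹) / 2 * (k * a) = -a := by field_simp; ring
  rw [e1] at h1
  rw [e2] at h2
  linarith

/-- Used for two values of c: one makes the coefficient 1 (the update to S + bb'), the other makes
it 0 (a reflection fixing S). -/
theorem mul_mul_transpose_one_add_smul_vecMulVec {n : ℕ} {S : Matrix (Fin n) (Fin n) ℝ}
    {b w : Fin n → ℝ} (hw : S.mulVec w = b) (hw' : Matrix.vecMul w S = b) (c : ℝ) :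
    (1 + c • Matrix.vecMulVec b w) * S * (1 + c • Matrix.vecMulVec b w).transpose =
      S + (2 * c + c ^ 2 * dotProduct w b) • Matrix.vecMulVec b b := by
  rw [Matrix.transpose_add, Matrix.transpose_one, Matrix.transpose_smul,
    Matrix.transpose_vecMulVec]
  have h1 : Matrix.vecMulVec b w * S = Matrix.vecMulVec b b := by
    rw [Matrix.vecMulVec_mul, hw']
  have h2 : S * Matrix.vecMulVec w b = Matrix.vecMulVec b b := by
    rw [Matrix.mul_vecMulVec, hw]
  have h3 : Matrix.vecMulVec b b * Matrix.vecMulVec w b =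
      dotProduct w b • Matrix.vecMulVec b b := by
    rw [Matrix.vecMulVec_mul_vecMulVec, dotProduct_comm]
    ext i j
    simp [Matrix.vecMulVec_apply]
    ring
  rw [Matrix.add_mul, Matrix.one_mul, Matrix.smul_mul, h1, Matrix.mul_add, Matrix.mul_one,
    Matrix.add_mul, Matrix.mul_smul, h2, Matrix.smul_mul, Matrix.mul_smul, h3]
  module

theorem toEuclideanLin_one_add_smul_vecMulVec {n : ℕ} (b w : EuclideanSpace ℝ (Fin n)) (c : ℝ)
    (x : EuclideanSpace ℝ (Fin n)) :
    Matrix.toEuclideanLin (1 + c • Matrix.vecMulVec b.ofLp w.ofLp) x =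
      x + (c * dotProduct w.ofLp x.ofLp) • b := by
  ext i
  simp [Matrix.vecMulVec_mulVec]
  ring

theorem posDef_add_vecMulVec {n : ℕ} {S : Matrix (Fin n) (Fin n) ℝ} (hS : S.PosDef)
    (b : Fin n → ℝ) : (S + Matrix.vecMulVec b b).PosDef := by
  have := Matrix.posSemidef_vecMulVec_self_star b
  rw [star_trivial] at this
  exact hS.add_posSemidef this

theorem det_ne_zero_of_posDef_mul_mul_transpose {n : ℕ} {S M : Matrix (Fin n) (Fin n) ℝ}
    (h : (M * S * M.transpose).PosDef) : M.det ≠ 0 := fun h0 => by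
  have := h.det_pos.ne'
  simp [h0] at this

theorem integral_ellipticalLaw_le_add_vecMulVec {n : ℕ} {S : Matrix (Fin n) (Fin n) ℝ}
    {h : ℝ → ENNReal} (hh : Measurable h) (hS : S.PosDef)
    [IsFiniteMeasure (ellipticalLaw (1 : Matrix (Fin n) (Fin n) ℝ) h)] (R : ℝ)
    {f : EuclideanSpace ℝ (Fin n) → ℝ} (hf : Continuous f) (hfc : ConvexAlongNonneg f)
    (b : EuclideanSpace ℝ (Fin n)) (hb : ∀ i, 0 ≤ b i) :
    ∫ x, f x ∂ellipticalLaw S ((Set.Iic R).indicator h) ≤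
      ∫ x, f x ∂ellipticalLaw (S + Matrix.vecMulVec b.ofLp b.ofLp)
        ((Set.Iic R).indicator h) := by
  have hh' : Measurable ((Set.Iic R).indicator h) := hh.indicator measurableSet_Iic
  rcases eq_or_ne b 0 with rfl | hb0
  · simp
  have hb0' : b.ofLp ≠ 0 := fun h0 => hb0 (by ext i; simp [h0])
  set w : EuclideanSpace ℝ (Fin n) := WithLp.toLp 2 (S⁻¹.mulVec b.ofLp) with hw
  have hu : IsUnit S.det := hS.det_pos.ne'.isUnit
  have hSw : S.mulVec w.ofLp = b.ofLp := by
    simp [hw, Matrix.mulVec_mulVec, Matrix.mul_nonsing_inv _ hu]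
  have hSt : S.transpose = S := by
    have := hS.isHermitian.eq
    rwa [Matrix.conjTranspose_eq_transpose_of_trivial] at this
  have hwS : Matrix.vecMul w.ofLp S = b.ofLp := by
    rw [← hSw]; conv_lhs => rw [← hSt, Matrix.vecMul_transpose]
  set s := dotProduct w.ofLp b.ofLp with hs
  have hspos : 0 < s := by
    have := hS.inv.dotProduct_mulVec_pos hb0'
    rw [star_trivial] at this
    rw [hs, dotProduct_comm]
    exact this
  have hq : 1 ≤ √(1 + s) := Real.one_le_sqrt.2 (by linarith)
  have hq2 : √(1 + s) ^ 2 = 1 + s := Real.sq_sqrt (by linarith)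
  -- The positive root of 2t + st² = 1; then 1 + ts = √(1+s) is the factor by which `M` stretches b.
  set t := (√(1 + s) - 1) / s with ht
  have hts : t * s = √(1 + s) - 1 := div_mul_cancel₀ _ hspos.ne'
  have ht1 : 2 * t + t ^ 2 * s = 1 := by
    have : (2 * t + t ^ 2 * s) * s = 1 * s := by
      calc (2 * t + t ^ 2 * s) * s = 2 * (t * s) + (t * s) ^ 2 := by ring
        _ = 1 * s := by rw [hts]; linarith
    exact mul_right_cancel₀ hspos.ne' this
  have hr0 : 2 * (-2 / s) + (-2 / s) ^ 2 * s = 0 := by field_simp; ring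
  set M := 1 + t • Matrix.vecMulVec b.ofLp w.ofLp with hM
  set ρ := 1 + (-2 / s) • Matrix.vecMulVec b.ofLp w.ofLp with hρ
  have hMS : M * S * M.transpose = S + Matrix.vecMulVec b.ofLp b.ofLp := by
    rw [hM, mul_mul_transpose_one_add_smul_vecMulVec hSw hwS, ← hs, ht1, one_smul]
  have hρS : ρ * S * ρ.transpose = S := by
    rw [hρ, mul_mul_transpose_one_add_smul_vecMulVec hSw hwS, ← hs, hr0, zero_smul, add_zero]
  have hS' := posDef_add_vecMulVec hS b.ofLp
  have hMd : M.det ≠ 0 := det_ne_zero_of_posDef_mul_mul_transpose (by rwa [hMS])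
  have hρd : ρ.det ≠ 0 :=
    det_ne_zero_of_posDef_mul_mul_transpose (S := S) (by rwa [hρS])
  have hMc := continuous_toEuclideanLin M
  have hρc := continuous_toEuclideanLin ρ
  have hint : ∀ {k : EuclideanSpace ℝ (Fin n) → ℝ}, Continuous k →
      Integrable k (ellipticalLaw S ((Set.Iic R).indicator h)) :=
    fun hk => integrable_ellipticalLaw_indicator hh hS R hk
  have hρint : ∀ {k : EuclideanSpace ℝ (Fin n) → ℝ}, Continuous k →
      ∫ x, k x ∂ellipticalLaw S ((Set.Iic R).indicator h) =
      ∫ x, k (Matrix.toEuclideanLin ρ x) ∂ellipticalLaw S ((Set.Iic R).indicator h) :=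
    fun {k} hk => by
      have e := map_ellipticalLaw (S := S) hh' hρd
      rw [hρS] at e
      conv_lhs => rw [← e]
      exact integral_map hρc.measurable.aemeasurable hk.aestronglyMeasurable
  have hMint : ∫ x, f x ∂ellipticalLaw (S + Matrix.vecMulVec b.ofLp b.ofLp)
      ((Set.Iic R).indicator h) = ∫ x, f (Matrix.toEuclideanLin M x)
        ∂ellipticalLaw S ((Set.Iic R).indicator h) := by
    rw [← hMS, ← map_ellipticalLaw hh' hMd]
    exact integral_map hMc.measurable.aemeasurable hf.aestronglyMeasurable
  -- Write x = (x - ab) + ab with w'(x - ab) = 0: `ρ` sends a to -a, and `M` sends a to √(1+s) a.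
  have hpt : ∀ x, f x + f (Matrix.toEuclideanLin ρ x) ≤ f (Matrix.toEuclideanLin M x) +
      f (Matrix.toEuclideanLin M (Matrix.toEuclideanLin ρ x)) := by
    intro x
    set a := dotProduct w.ofLp x.ofLp / s with ha
    have has : dotProduct w.ofLp x.ofLp = a * s := (div_mul_cancel₀ _ hspos.ne').symm
    have hρx : Matrix.toEuclideanLin ρ x = (x - a • b) + (-a) • b := by
      rw [hρ, toEuclideanLin_one_add_smul_vecMulVec, has,
        show -2 / s * (a * s) = -2 * a by field_simp]
      module
    have hMx : Matrix.toEuclideanLin M x = (x - a • b) + (√(1 + s) * a) • b := by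
      rw [hM, toEuclideanLin_one_add_smul_vecMulVec, has,
        show t * (a * s) = (t * s) * a by ring, hts]
      module
    have hMρx : Matrix.toEuclideanLin M (Matrix.toEuclideanLin ρ x) =
        (x - a • b) + (-(√(1 + s) * a)) • b := by
      rw [hρx, hM, toEuclideanLin_one_add_smul_vecMulVec]
      have : dotProduct w.ofLp ((x - a • b) + (-a) • b : EuclideanSpace ℝ (Fin n)).ofLp
          = -(a * s) := by
        simp only [WithLp.ofLp_add, WithLp.ofLp_sub, WithLp.ofLp_smul, dotProduct_add,
          dotProduct_sub, dotProduct_smul, smul_eq_mul, has, ← hs]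
        ring
      rw [this, show t * -(a * s) = -((t * s) * a) by ring, hts]
      module
    have hx : f x = f ((x - a • b) + a • b) := by congr 1; module
    rw [hMρx, hMx, hρx, hx]
    exact (hfc (x - a • b) b hb).add_neg_le_add_neg_mul a hq
  -- By invariance under `ρ`, each side integrates to twice a single integral.
  have h1 := integral_mono (μ := ellipticalLaw S ((Set.Iic R).indicator h))
    ((hint hf).add (hint (hf.comp hρc)))
    ((hint (hf.comp hMc)).add (hint ((hf.comp hMc).comp hρc))) hpt
  rw [integral_add' (hint hf) (hint (hf.comp hρc)),
    integral_add' (hint (hf.comp hMc)) (hint ((hf.comp hMc).comp hρc))] at h1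
  have e1 := hρint hf
  have e2 := hρint (hf.comp hMc)
  simp only [Function.comp_apply] at h1 e2
  rw [← e1, ← e2, ← hMint] at h1
  linarith

theorem integral_ellipticalLaw_le_of_isCompletelyPositive {n : ℕ}
    {S₁ S₂ : Matrix (Fin n) (Fin n) ℝ} {h : ℝ → ENNReal} (hh : Measurable h) (hS : S₁.PosDef)
    [IsFiniteMeasure (ellipticalLaw (1 : Matrix (Fin n) (Fin n) ℝ) h)] (R : ℝ)
    {f : EuclideanSpace ℝ (Fin n) → ℝ} (hf : Continuous f) (hfc : ConvexAlongNonneg f)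
    (hcp : IsCompletelyPositive (S₂ - S₁)) :
    ∫ x, f x ∂ellipticalLaw S₁ ((Set.Iic R).indicator h) ≤
      ∫ x, f x ∂ellipticalLaw S₂ ((Set.Iic R).indicator h) := by
  obtain ⟨m, B, hB, hBS⟩ := hcp
  -- The rows of `B` are added one at a time; positive definiteness is carried along because the
  -- rank-one step needs it.
  have key : ∀ s : Finset (Fin m), (S₁ + ∑ k ∈ s, Matrix.vecMulVec (B k) (B k)).PosDef ∧
      ∫ x, f x ∂ellipticalLaw S₁ ((Set.Iic R).indicator h) ≤
      ∫ x, f x ∂ellipticalLaw (S₁ + ∑ k ∈ s, Matrix.vecMulVec (B k) (B k))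
        ((Set.Iic R).indicator h) := by
    intro s
    induction s using Finset.induction_on with
    | empty => simpa using hS
    | insert k s hk ih =>
      rw [Finset.sum_insert hk, add_comm (Matrix.vecMulVec _ _), ← add_assoc]
      exact ⟨posDef_add_vecMulVec ih.1 _, ih.2.trans
        (integral_ellipticalLaw_le_add_vecMulVec hh ih.1 R hf hfc (WithLp.toLp 2 (B k)) (hB k))⟩
  have hS₂ : S₂ = S₁ + ∑ k, Matrix.vecMulVec (B k) (B k) := by
    rw [← sub_eq_iff_eq_add', hBS]
    ext i j
    simp [Matrix.mul_apply, Matrix.sum_apply, Matrix.vecMulVec_apply]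
  rw [hS₂]
  exact (key Finset.univ).2

/-! ### Mixtures and the sufficiency direction -/

/-- The density generator `g` with its normalizing constant, as a function to `[0, ∞]`. -/
noncomputable def normalizedGenerator (n : ℕ) (g : ℝ → ℝ) (u : ℝ) : ENNReal :=
  ENNReal.ofReal (normalizingConst n g * g u)

/-- The map `(x, z) ↦ μ + α(z) x + β(z) δ`. -/
noncomputable def locationScale {n q : ℕ} (μ δ : EuclideanSpace ℝ (Fin n))
    (α β : EuclideanSpace ℝ (Fin q) → ℝ)
    (p : EuclideanSpace ℝ (Fin n) × EuclideanSpace ℝ (Fin q)) : EuclideanSpace ℝ (Fin n) :=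
  μ + α p.2 • p.1 + β p.2 • δ

theorem measurable_locationScale {n q : ℕ} (μ δ : EuclideanSpace ℝ (Fin n))
    {α β : EuclideanSpace ℝ (Fin q) → ℝ} (hα : Measurable α) (hβ : Measurable β) :
    Measurable (locationScale μ δ α β) := by
  unfold locationScale
  fun_prop

theorem HasDensityGenerator.eq_ellipticalLaw {n : ℕ} {ν : Measure (EuclideanSpace ℝ (Fin n))}
    {S : Matrix (Fin n) (Fin n) ℝ} {g : ℝ → ℝ} (h : HasDensityGenerator ν 0 S g) :
    ν = ellipticalLaw S (normalizedGenerator n g) := by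
  rw [h.density, ellipticalLaw]
  congr 1
  ext x
  rw [normalizedGenerator, ← ENNReal.ofReal_mul (by positivity), sub_zero]
  congr 1
  ring

namespace IsLSE

variable {n q : ℕ} {Ω : Type*} [MeasurableSpace Ω] {P : Measure Ω}
  {Y : Ω → EuclideanSpace ℝ (Fin n)} {μ δ : EuclideanSpace ℝ (Fin n)}
  {S : Matrix (Fin n) (Fin n) ℝ} {ψ g : ℝ → ℝ} {α β : EuclideanSpace ℝ (Fin q) → ℝ}
  {H : Measure (EuclideanSpace ℝ (Fin q))}

theorem measurable_normalizedGenerator (hY : IsLSE P Y μ S δ ψ g α β H) :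
    Measurable (normalizedGenerator n g) := by
  obtain ⟨ν, -, -, hg, -⟩ := hY.law
  exact (hg.measurable.const_mul _).ennreal_ofReal

theorem isProbabilityMeasure (hY : IsLSE P Y μ S δ ψ g α β H) :
    IsProbabilityMeasure (ellipticalLaw S (normalizedGenerator n g)) := by
  obtain ⟨ν, hν, -, hg, -⟩ := hY.law
  rwa [← hg.eq_ellipticalLaw]

theorem isProbabilityMeasure_one (hY : IsLSE P Y μ S δ ψ g α β H) :
    IsProbabilityMeasure
      (ellipticalLaw (1 : Matrix (Fin n) (Fin n) ℝ) (normalizedGenerator n g)) :=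
  ⟨by
    rw [← ellipticalLaw_univ hY.measurable_normalizedGenerator hY.posDef]
    exact hY.isProbabilityMeasure.measure_univ⟩

theorem map_eq (hY : IsLSE P Y μ S δ ψ g α β H) :
    P.map Y = ((ellipticalLaw S (normalizedGenerator n g)).prod H).map
      (locationScale μ δ α β) := by
  obtain ⟨ν, -, -, hg, h⟩ := hY.law
  rw [h, hg.eq_ellipticalLaw]
  rfl

theorem measurable_map (hY : IsLSE P Y μ S δ ψ g α β H) :
    Measurable (locationScale μ δ α β) :=
  measurable_locationScale μ δ hY.measurable_scale hY.measurable_loc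

theorem integrable_comp_iff (hY : IsLSE P Y μ S δ ψ g α β H)
    {f : EuclideanSpace ℝ (Fin n) → ℝ} (hf : Continuous f) :
    Integrable (fun ω => f (Y ω)) P ↔ Integrable (fun p => f (locationScale μ δ α β p))
      ((ellipticalLaw S (normalizedGenerator n g)).prod H) := by
  have h1 := integrable_map_measure (μ := P) (f := Y) (g := f) hf.aestronglyMeasurable
    hY.aemeasurable
  have h2 := integrable_map_measure (μ := (ellipticalLaw S (normalizedGenerator n g)).prod H)
    (f := locationScale μ δ α β) (g := f) hf.aestronglyMeasurable hY.measurable_map.aemeasurable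
  rw [hY.map_eq] at h1
  exact h1.symm.trans h2

theorem integral_comp (hY : IsLSE P Y μ S δ ψ g α β H)
    {f : EuclideanSpace ℝ (Fin n) → ℝ} (hf : Continuous f) :
    ∫ ω, f (Y ω) ∂P = ∫ p, f (locationScale μ δ α β p)
      ∂(ellipticalLaw S (normalizedGenerator n g)).prod H := by
  rw [← integral_map hY.aemeasurable hf.aestronglyMeasurable, hY.map_eq,
    integral_map hY.measurable_map.aemeasurable hf.aestronglyMeasurable]

end IsLSE

theorem ConvexAlongNonneg.comp_affine {n : ℕ} {f : EuclideanSpace ℝ (Fin n) → ℝ}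
    (hf : ConvexAlongNonneg f) (μ v : EuclideanSpace ℝ (Fin n)) {a : ℝ} (ha : 0 ≤ a) :
    ConvexAlongNonneg fun x => f (μ + a • x + v) := by
  intro x b hb
  have := hf (μ + a • x + v) (a • b) fun i => mul_nonneg ha (hb i)
  convert this using 3 with t
  module

/-- Truncated expectations of a law on a product, over the ellipsoids of a given level. -/
theorem tendsto_setIntegral_ellipsoid {n q : ℕ} (A : Matrix (Fin n) (Fin n) ℝ)
    (ν : Measure (EuclideanSpace ℝ (Fin n) × EuclideanSpace ℝ (Fin q)))
    {F : EuclideanSpace ℝ (Fin n) × EuclideanSpace ℝ (Fin q) → ℝ} (hF : Integrable F ν) :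
    Filter.Tendsto (fun k : ℕ => ∫ p in {x | matQuadForm A x ≤ k} ×ˢ Set.univ, F p ∂ν)
      Filter.atTop (nhds (∫ p, F p ∂ν)) := by
  have hU : ⋃ k : ℕ, ({x | matQuadForm A x ≤ k} ×ˢ (Set.univ : Set (EuclideanSpace ℝ (Fin q)))) =
      Set.univ := by
    refine Set.eq_univ_of_forall fun p => Set.mem_iUnion.2 ?_
    obtain ⟨k, hk⟩ := exists_nat_ge (matQuadForm A p.1)
    exact ⟨k, hk, trivial⟩
  have := tendsto_setIntegral_of_monotone (μ := ν) (f := F)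
    (s := fun k : ℕ => {x | matQuadForm A x ≤ k} ×ˢ (Set.univ : Set (EuclideanSpace ℝ (Fin q))))
    (fun k => (measurableSet_le (continuous_matQuadForm A).measurable
      measurable_const).prod MeasurableSet.univ)
    (fun k l hkl => Set.prod_mono (fun x (hx : _ ≤ (k : ℝ)) => hx.trans (by exact_mod_cast hkl))
      subset_rfl) (by rw [hU]; exact hF.integrableOn)
  rwa [hU, setIntegral_univ] at this

theorem copOrder_of_isCompletelyPositive {n q : ℕ}
    {Ω₁ Ω₂ : Type*} [MeasurableSpace Ω₁] [MeasurableSpace Ω₂]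
    {P₁ : Measure Ω₁} {P₂ : Measure Ω₂}
    {Y₁ : Ω₁ → EuclideanSpace ℝ (Fin n)} {Y₂ : Ω₂ → EuclideanSpace ℝ (Fin n)}
    {μ δ : EuclideanSpace ℝ (Fin n)} {S₁ S₂ : Matrix (Fin n) (Fin n) ℝ}
    {ψ g : ℝ → ℝ} {α β : EuclideanSpace ℝ (Fin q) → ℝ}
    {H : Measure (EuclideanSpace ℝ (Fin q))} [IsProbabilityMeasure H]
    (hY₁ : IsLSE P₁ Y₁ μ S₁ δ ψ g α β H) (hY₂ : IsLSE P₂ Y₂ μ S₂ δ ψ g α β H)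
    (hcp : IsCompletelyPositive (S₂ - S₁)) : CopOrder P₁ P₂ Y₁ Y₂ := by
  intro f hf hc hi₁ hi₂
  have hfc := convexAlongNonneg_of_isCopositive hf hc
  have hcont := hf.continuous
  have hh := hY₁.measurable_normalizedGenerator
  have hp1 := hY₁.isProbabilityMeasure
  have hp2 := hY₂.isProbabilityMeasure
  have hp0 := hY₁.isProbabilityMeasure_one
  rw [hY₁.integrable_comp_iff hcont] at hi₁
  rw [hY₂.integrable_comp_iff hcont] at hi₂
  rw [hY₁.integral_comp hcont, hY₂.integral_comp hcont]
  -- The two laws are cut off at different ellipsoids of the same level, which correspond to one and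
  -- the same truncated generator.
  refine le_of_tendsto_of_tendsto' (tendsto_setIntegral_ellipsoid S₁⁻¹ _ hi₁)
    (tendsto_setIntegral_ellipsoid S₂⁻¹ _ hi₂) fun k => ?_
  have hprod : ∀ S : Matrix (Fin n) (Fin n) ℝ,
      IsProbabilityMeasure (ellipticalLaw S (normalizedGenerator n g)) →
      ((ellipticalLaw S (normalizedGenerator n g)).prod H).restrict
        ({x | matQuadForm S⁻¹ x ≤ k} ×ˢ Set.univ) =
      (ellipticalLaw S ((Set.Iic (k : ℝ)).indicator (normalizedGenerator n g))).prod H := by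
    intro S hS
    rw [ellipticalLaw_indicator, ← Measure.prod_restrict, Measure.restrict_univ]
  have hsf : ∀ S : Matrix (Fin n) (Fin n) ℝ,
      IsProbabilityMeasure (ellipticalLaw S (normalizedGenerator n g)) → SFinite
      (ellipticalLaw S ((Set.Iic (k : ℝ)).indicator (normalizedGenerator n g))) := by
    intro S hS
    rw [ellipticalLaw_indicator]
    infer_instance
  have hs1 := hsf S₁ hp1
  have hs2 := hsf S₂ hp2
  have hr1 := hi₁.integrableOn (s := {x | matQuadForm S₁⁻¹ x ≤ (k : ℝ)} ×ˢ Set.univ)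
  have hr2 := hi₂.integrableOn (s := {x | matQuadForm S₂⁻¹ x ≤ (k : ℝ)} ×ˢ Set.univ)
  rw [IntegrableOn, hprod S₁ hp1] at hr1
  rw [IntegrableOn, hprod S₂ hp2] at hr2
  rw [hprod S₁ hp1, hprod S₂ hp2, integral_prod_symm _ hr1, integral_prod_symm _ hr2]
  -- Conditionally on z, the test function is precomposed with an affine map of slope α(z) ≥ 0,
  -- which preserves convexity along nonnegative directions.
  refine integral_mono hr1.integral_prod_right hr2.integral_prod_right fun z => ?_
  refine integral_ellipticalLaw_le_of_isCompletelyPositive hh hY₁.posDef k ?_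
    (hfc.comp_affine μ (β z • δ) (hY₁.scale_nonneg z)) hcp
  simp only [locationScale]
  fun_prop

/-! ### Second moments of elliptical laws -/

theorem matQuadForm_eq_sum {n : ℕ} (A : Matrix (Fin n) (Fin n) ℝ)
    (x : EuclideanSpace ℝ (Fin n)) : matQuadForm A x = ∑ i, ∑ j, A i j * (x i * x j) :=
  sum_mul_mul_eq_dotProduct A x.ofLp

theorem MeasureTheory.MemLp.integrable_apply_mul_apply {X : Type*} [MeasurableSpace X]
    {m : Measure X} {n : ℕ} {u : X → EuclideanSpace ℝ (Fin n)} (hu : MemLp u 2 m) (i j : Fin n) :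
    Integrable (fun x => u x i * u x j) m := by
  have h : ∀ i, MemLp (fun x => u x i) 2 m := fun i =>
    (EuclideanSpace.proj i : EuclideanSpace ℝ (Fin n) →L[ℝ] ℝ).comp_memLp' hu
  exact (h i).integrable_mul (h j)

theorem MeasureTheory.MemLp.integrable_matQuadForm {X : Type*} [MeasurableSpace X]
    {m : Measure X} {n : ℕ} {u : X → EuclideanSpace ℝ (Fin n)} (hu : MemLp u 2 m)
    (A : Matrix (Fin n) (Fin n) ℝ) : Integrable (fun x => matQuadForm A (u x)) m := by
  simp only [matQuadForm_eq_sum]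
  exact integrable_finsetSum _ fun i _ => integrable_finsetSum _ fun j _ =>
    (hu.integrable_apply_mul_apply i j).const_mul _

section SecondMoments

variable {n : ℕ} {h : ℝ → ENNReal}

theorem measurePreserving_ellipticalLaw_one (hh : Measurable h) {M : Matrix (Fin n) (Fin n) ℝ}
    (hM : M * M.transpose = 1) :
    MeasurePreserving (Matrix.toEuclideanLin M) (ellipticalLaw 1 h) (ellipticalLaw 1 h) := by
  refine ⟨(continuous_toEuclideanLin M).measurable, ?_⟩
  have hd : M.det ≠ 0 := fun h0 => by
    have := congrArg Matrix.det hM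
    simp [h0] at this
  rw [map_ellipticalLaw hh hd, Matrix.mul_one, hM]

theorem measurePreserving_neg_ellipticalLaw (hh : Measurable h)
    (S : Matrix (Fin n) (Fin n) ℝ) :
    MeasurePreserving (fun x => -x) (ellipticalLaw S h) (ellipticalLaw S h) := by
  refine ⟨measurable_neg, ?_⟩
  have hd : (-1 : Matrix (Fin n) (Fin n) ℝ).det ≠ 0 := by
    rw [Matrix.det_neg, Matrix.det_one]
    simp
  have := map_ellipticalLaw (S := S) hh hd
  have hT : (Matrix.toEuclideanLin (-1 : Matrix (Fin n) (Fin n) ℝ) :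
      EuclideanSpace ℝ (Fin n) → EuclideanSpace ℝ (Fin n)) = fun x => -x := by
    ext x i
    simp
  rw [hT] at this
  rw [this]
  simp

theorem ellipticalLaw_ae_ne_zero (hn : 1 ≤ n) (S : Matrix (Fin n) (Fin n) ℝ) :
    ∀ᵐ x ∂ellipticalLaw S h, x ≠ 0 := by
  have : Nonempty (Fin n) := ⟨⟨0, hn⟩⟩
  have hv : ∀ᵐ x ∂(volume : Measure (EuclideanSpace ℝ (Fin n))), x ≠ 0 := by
    rw [ae_iff]
    simp
  exact (withDensity_absolutelyContinuous _ _).ae_le hv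

/-- The sign change of coordinate i preserves the spherical law and negates the integrand. -/
theorem integral_apply_mul_apply_of_ne (hh : Measurable h) {i j : Fin n} (hij : i ≠ j) :
    ∫ x, x i * x j ∂ellipticalLaw (1 : Matrix (Fin n) (Fin n) ℝ) h = 0 := by
  have hM : Matrix.diagonal (Function.update (1 : Fin n → ℝ) i (-1)) *
      (Matrix.diagonal (Function.update (1 : Fin n → ℝ) i (-1))).transpose = 1 := by
    rw [Matrix.diagonal_transpose, Matrix.diagonal_mul_diagonal, ← Matrix.diagonal_one]
    congr 1
    ext k
    by_cases hk : k = i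
    · subst hk; simp
    · simp [hk]
  have hp := measurePreserving_ellipticalLaw_one hh hM
  have e := integral_map (μ := ellipticalLaw (1 : Matrix (Fin n) (Fin n) ℝ) h)
    hp.measurable.aemeasurable
    (f := fun x : EuclideanSpace ℝ (Fin n) => x i * x j)
    (Continuous.aestronglyMeasurable (by fun_prop))
  rw [hp.map_eq] at e
  simp [Matrix.mulVec_diagonal, hij.symm, integral_neg] at e
  linarith

theorem integral_apply_mul_self (hh : Measurable h) (i j : Fin n) :
    ∫ x, x i * x i ∂ellipticalLaw (1 : Matrix (Fin n) (Fin n) ℝ) h =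
      ∫ x, x j * x j ∂ellipticalLaw (1 : Matrix (Fin n) (Fin n) ℝ) h := by
  have hM : (Equiv.swap i j).permMatrix ℝ * ((Equiv.swap i j).permMatrix ℝ).transpose = 1 := by
    rw [Matrix.transpose_permMatrix, ← Matrix.permMatrix_mul]
    simp
  have hp := measurePreserving_ellipticalLaw_one hh hM
  have e := integral_map (μ := ellipticalLaw (1 : Matrix (Fin n) (Fin n) ℝ) h)
    hp.measurable.aemeasurable
    (f := fun x : EuclideanSpace ℝ (Fin n) => x i * x i)
    (Continuous.aestronglyMeasurable (by fun_prop))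
  rw [hp.map_eq] at e
  simpa [Matrix.permMatrix_mulVec] using e

theorem integral_matQuadForm_ellipticalLaw_one (hh : Measurable h)
    (hm : MemLp id 2 (ellipticalLaw (1 : Matrix (Fin n) (Fin n) ℝ) h))
    (A : Matrix (Fin n) (Fin n) ℝ) (k : Fin n) :
    ∫ x, matQuadForm A x ∂ellipticalLaw 1 h =
      (∫ x, x k * x k ∂ellipticalLaw (1 : Matrix (Fin n) (Fin n) ℝ) h) * A.trace := by
  have hi : ∀ i j, Integrable (fun x : EuclideanSpace ℝ (Fin n) => A i j * (x i * x j))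
      (ellipticalLaw 1 h) := fun i j => (hm.integrable_apply_mul_apply i j).const_mul _
  simp only [matQuadForm_eq_sum]
  rw [integral_finsetSum _ fun i _ => integrable_finsetSum _ fun j _ => hi i j]
  simp only [Matrix.trace, Matrix.diag_apply, Finset.mul_sum]
  refine Finset.sum_congr rfl fun i _ => ?_
  rw [integral_finsetSum _ fun j _ => hi i j, Finset.sum_eq_single i]
  · rw [integral_const_mul, integral_apply_mul_self hh i k, mul_comm]
  · intro j _ hj
    rw [integral_const_mul, integral_apply_mul_apply_of_ne hh hj.symm, mul_zero]
  · simp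

theorem memLp_ellipticalLaw_one (hh : Measurable h) {S : Matrix (Fin n) (Fin n) ℝ}
    (hS : S.PosDef) (hm : MemLp id 2 (ellipticalLaw S h)) :
    MemLp id 2 (ellipticalLaw (1 : Matrix (Fin n) (Fin n) ℝ) h) := by
  obtain ⟨L, hL, rfl⟩ := exists_eq_mul_transpose hS
  have hu : IsUnit L.det := hL.isUnit
  have hd : L⁻¹.det ≠ 0 := by
    rw [Matrix.det_nonsing_inv, Ring.inverse_eq_inv']
    exact inv_ne_zero hL
  have e := map_ellipticalLaw (S := L * L.transpose) hh hd
  rw [← Matrix.mul_assoc, Matrix.nonsing_inv_mul _ hu, Matrix.one_mul, ← Matrix.transpose_mul,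
    Matrix.nonsing_inv_mul _ hu, Matrix.transpose_one] at e
  rw [← e, memLp_map_measure_iff aestronglyMeasurable_id
    (continuous_toEuclideanLin _).measurable.aemeasurable]
  exact (LinearMap.toContinuousLinearMap (Matrix.toEuclideanLin L⁻¹)).comp_memLp' hm

/-- With S = LL', the law is the image under L of the spherical one, whose second moment matrix is κ
times the identity. Hence E XX' = κS, with κ depending on the generator and not on S. -/
theorem integral_matQuadForm_ellipticalLaw (hh : Measurable h) {S : Matrix (Fin n) (Fin n) ℝ}
    (hS : S.PosDef) (hm : MemLp id 2 (ellipticalLaw S h)) (A : Matrix (Fin n) (Fin n) ℝ)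
    (k : Fin n) :
    ∫ x, matQuadForm A x ∂ellipticalLaw S h =
      (∫ x, x k * x k ∂ellipticalLaw (1 : Matrix (Fin n) (Fin n) ℝ) h) *
        ∑ i, ∑ j, A i j * S i j := by
  have hm1 := memLp_ellipticalLaw_one hh hS hm
  have hSt : S.transpose = S := by
    have := hS.isHermitian.eq
    rwa [Matrix.conjTranspose_eq_transpose_of_trivial] at this
  have htr : (A * S).trace = ∑ i, ∑ j, A i j * S i j := by
    conv_lhs => rw [← hSt]
    simp [Matrix.trace, Matrix.mul_apply]
  obtain ⟨L, hL, rfl⟩ := exists_eq_mul_transpose hS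
  rw [ellipticalLaw_eq_map_one hh hL,
    integral_map (continuous_toEuclideanLin L).measurable.aemeasurable
      (continuous_matQuadForm A).aestronglyMeasurable]
  simp only [matQuadForm_toEuclideanLin]
  rw [integral_matQuadForm_ellipticalLaw_one hh hm1 _ k, ← htr, Matrix.mul_assoc,
    Matrix.trace_mul_comm, Matrix.mul_assoc]

/-- Otherwise, by exchangeability, all coordinates vanish almost surely, although a law with a
density has no atom at 0. -/
theorem integral_apply_mul_self_pos (hh : Measurable h)
    [IsProbabilityMeasure (ellipticalLaw (1 : Matrix (Fin n) (Fin n) ℝ) h)]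
    (hm : MemLp id 2 (ellipticalLaw (1 : Matrix (Fin n) (Fin n) ℝ) h)) (k : Fin n) :
    0 < ∫ x, x k * x k ∂ellipticalLaw (1 : Matrix (Fin n) (Fin n) ℝ) h := by
  refine lt_of_le_of_ne (integral_nonneg fun x => mul_self_nonneg _) fun h0 => ?_
  have hz : ∀ i : Fin n, ∀ᵐ x ∂ellipticalLaw (1 : Matrix (Fin n) (Fin n) ℝ) h, x i = 0 := by
    intro i
    rw [integral_apply_mul_self hh k i] at h0
    have := (integral_eq_zero_iff_of_nonneg (fun x : EuclideanSpace ℝ (Fin n) =>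
      mul_self_nonneg (x i)) (hm.integrable_apply_mul_apply i i)).1 h0.symm
    filter_upwards [this] with x hx
    exact mul_self_eq_zero.1 hx
  obtain ⟨x, hx, hx0⟩ := ((ae_all_iff.2 hz).and
    (ellipticalLaw_ae_ne_zero (h := h) (Nat.one_le_iff_ne_zero.2 (Fin.pos k).ne') 1)).exists
  exact hx0 (by ext i; simp [hx i])

end SecondMoments

/-! ### Moments of the mixture -/

namespace IsLSE

variable {n q : ℕ} {Ω : Type*} [MeasurableSpace Ω] {P : Measure Ω}
  {Y : Ω → EuclideanSpace ℝ (Fin n)} {μ δ : EuclideanSpace ℝ (Fin n)}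
  {S : Matrix (Fin n) (Fin n) ℝ} {ψ g : ℝ → ℝ} {α β : EuclideanSpace ℝ (Fin q) → ℝ}
  {H : Measure (EuclideanSpace ℝ (Fin q))}

theorem memLp_locationScale (hY : IsLSE P Y μ S δ ψ g α β H) (h2 : MemLp Y 2 P) :
    MemLp (locationScale μ δ α β) 2 ((ellipticalLaw S (normalizedGenerator n g)).prod H) := by
  have h1 := (memLp_map_measure_iff (p := 2) (g := id) aestronglyMeasurable_id
    hY.aemeasurable).2 h2
  rw [hY.map_eq] at h1
  exact (memLp_map_measure_iff aestronglyMeasurable_id hY.measurable_map.aemeasurable).1 h1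

variable [IsProbabilityMeasure H]

theorem measurePreserving_neg (hY : IsLSE P Y μ S δ ψ g α β H) :
    MeasurePreserving (Prod.map (fun x => -x) id)
      ((ellipticalLaw S (normalizedGenerator n g)).prod H)
      ((ellipticalLaw S (normalizedGenerator n g)).prod H) := by
  have := hY.isProbabilityMeasure
  exact (measurePreserving_neg_ellipticalLaw hY.measurable_normalizedGenerator S).prod
    (MeasurePreserving.id H)

/-- The joint law is invariant under x ↦ -x; half the difference of Y and its reflected version
isolates α(Z)X, half the sum isolates μ + β(Z)δ. Square integrability of Y thus passes to each part.
-/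
theorem memLp_scale (hY : IsLSE P Y μ S δ ψ g α β H) (h2 : MemLp Y 2 P) :
    MemLp (fun p : EuclideanSpace ℝ (Fin n) × EuclideanSpace ℝ (Fin q) => α p.2 • p.1) 2
      ((ellipticalLaw S (normalizedGenerator n g)).prod H) := by
  have h1 := hY.memLp_locationScale h2
  have h3 := (h1.sub (h1.comp_measurePreserving hY.measurePreserving_neg)).const_smul (1 / 2 : ℝ)
  refine MemLp.ae_eq (.of_forall fun p => ?_) h3
  simp only [Pi.smul_apply, Pi.sub_apply, Function.comp_apply, locationScale, Prod.map, id]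
  module

theorem memLp_loc (hY : IsLSE P Y μ S δ ψ g α β H) (h2 : MemLp Y 2 P) :
    MemLp (fun p : EuclideanSpace ℝ (Fin n) × EuclideanSpace ℝ (Fin q) => μ + β p.2 • δ) 2
      ((ellipticalLaw S (normalizedGenerator n g)).prod H) := by
  have h1 := hY.memLp_locationScale h2
  have h3 := (h1.add (h1.comp_measurePreserving hY.measurePreserving_neg)).const_smul (1 / 2 : ℝ)
  refine MemLp.ae_eq (.of_forall fun p => ?_) h3
  simp only [Pi.smul_apply, Pi.add_apply, Function.comp_apply, locationScale, Prod.map, id]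
  module

theorem integrable_loc (hY : IsLSE P Y μ S δ ψ g α β H) (h2 : MemLp Y 2 P) (hδ : δ ≠ 0) :
    Integrable β H := by
  have := hY.isProbabilityMeasure
  have h1 := ((hY.memLp_loc h2).sub (memLp_const μ)).integrable (by norm_num)
  have h3 : Integrable (fun p : EuclideanSpace ℝ (Fin n) × EuclideanSpace ℝ (Fin q) => β p.2 • δ)
      ((ellipticalLaw S (normalizedGenerator n g)).prod H) := by
    refine h1.congr (.of_forall fun p => ?_)
    simp
  obtain ⟨x, hx⟩ := h3.prod_right_ae.exists
  exact (integrable_smul_const hδ).1 hx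

/-- By Fubini almost every z-section of |α(z)x|² is integrable; one with α(z) ≠ 0 suffices. -/
theorem memLp_id (hY : IsLSE P Y μ S δ ψ g α β H) (h2 : MemLp Y 2 P)
    (hα : ¬ ∀ᵐ z ∂H, α z = 0) :
    MemLp id 2 (ellipticalLaw S (normalizedGenerator n g)) := by
  have := hY.isProbabilityMeasure
  rw [memLp_two_iff_integrable_sq_norm aestronglyMeasurable_id]
  have h1 := (hY.memLp_scale h2).integrable_norm_pow (by norm_num)
  obtain ⟨z, hz, hz0⟩ := (h1.prod_left_ae.and_frequently (Filter.not_eventually.1 hα)).exists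
  simp only [norm_smul, mul_pow] at hz
  exact (integrable_const_mul_iff (pow_ne_zero 2 (norm_ne_zero_iff.2 hz0)).isUnit _).1 hz

theorem integrable_scale_sq (hY : IsLSE P Y μ S δ ψ g α β H) (hn : 1 ≤ n) (h2 : MemLp Y 2 P) :
    Integrable (fun z => α z ^ 2) H := by
  have := hY.isProbabilityMeasure
  have h1 := (hY.memLp_scale h2).integrable_norm_pow (by norm_num)
  obtain ⟨x, hx, hx0⟩ := (h1.prod_right_ae.and
    (ellipticalLaw_ae_ne_zero (h := normalizedGenerator n g) hn S)).exists
  simp only [norm_smul, mul_pow] at hx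
  have h3 := (integrable_mul_const_iff (pow_ne_zero 2 (norm_ne_zero_iff.2 hx0)).isUnit _).1 hx
  simpa using h3

theorem integral_scale_sq_pos (hY : IsLSE P Y μ S δ ψ g α β H) (hn : 1 ≤ n) (h2 : MemLp Y 2 P)
    (hα : ¬ ∀ᵐ z ∂H, α z = 0) : 0 < ∫ z, α z ^ 2 ∂H := by
  refine lt_of_le_of_ne (integral_nonneg fun z => sq_nonneg _) fun h0 => hα ?_
  filter_upwards [(integral_eq_zero_iff_of_nonneg (fun z => sq_nonneg (α z))
    (hY.integrable_scale_sq hn h2)).1 h0.symm] with z hz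
  exact pow_eq_zero_iff two_ne_zero |>.1 hz

theorem integral_clm (hY : IsLSE P Y μ S δ ψ g α β H) (h2 : MemLp Y 2 P)
    (l : EuclideanSpace ℝ (Fin n) →L[ℝ] ℝ) :
    ∫ ω, l (Y ω) ∂P = l μ + (∫ z, β z ∂H) * l δ := by
  have := hY.isProbabilityMeasure
  set π := (ellipticalLaw S (normalizedGenerator n g)).prod H with hπ
  have hX := l.integrable_comp ((hY.memLp_scale h2).integrable (by norm_num))
  have hm := l.integrable_comp ((hY.memLp_loc h2).integrable (by norm_num))
  have h0 : ∫ p, l (α p.2 • p.1) ∂π = 0 := by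
    have e := integral_map (μ := π) hY.measurePreserving_neg.measurable.aemeasurable
      (f := fun p => l (α p.2 • p.1)) (by rw [hY.measurePreserving_neg.map_eq]; exact hX.1)
    rw [hY.measurePreserving_neg.map_eq] at e
    simp only [Prod.map, id, smul_neg, map_neg, integral_neg] at e
    linarith
  have e1 : ∀ p : EuclideanSpace ℝ (Fin n) × EuclideanSpace ℝ (Fin q),
      l (locationScale μ δ α β p) = l (μ + β p.2 • δ) + l (α p.2 • p.1) := fun p => by
    simp only [locationScale, map_add]
    ring
  rw [hY.integral_comp l.continuous]
  simp only [e1]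
  rw [integral_add hm hX, h0, add_zero,
    integral_fun_snd (μ := ellipticalLaw S (normalizedGenerator n g)) (ν := H)
      (fun z => l (μ + β z • δ))]
  simp only [probReal_univ, map_add, map_smul, smul_eq_mul]
  -- If δ = 0, then β may fail to be integrable, but its integral only appears multiplied by l(δ) =
  -- 0.
  have hb : Integrable (fun z => β z * l δ) H := by
    rcases eq_or_ne δ 0 with rfl | hδ
    · simp
    · exact (hY.integrable_loc h2 hδ).mul_const _
  rw [integral_add (integrable_const _) hb, integral_const, integral_mul_const]
  simp

theorem integral_matQuadForm (hY : IsLSE P Y μ S δ ψ g α β H) (h2 : MemLp Y 2 P)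
    (A : Matrix (Fin n) (Fin n) ℝ) :
    ∫ ω, matQuadForm A (Y ω) ∂P = ∫ z, matQuadForm A (μ + β z • δ) ∂H +
      (∫ z, α z ^ 2 ∂H) *
        ∫ x, matQuadForm A x ∂ellipticalLaw S (normalizedGenerator n g) := by
  have := hY.isProbabilityMeasure
  set π := (ellipticalLaw S (normalizedGenerator n g)).prod H with hπ
  have hX := (hY.memLp_scale h2).integrable_matQuadForm A
  have hm := (hY.memLp_loc h2).integrable_matQuadForm A
  have hL := (hY.memLp_locationScale h2).integrable_matQuadForm A
  have hN := hY.measurePreserving_neg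
  have hL' : Integrable (fun p => matQuadForm A (locationScale μ δ α β
      (Prod.map (fun x => -x) id p))) π :=
    (hN.integrable_comp hL.1).2 hL
  have e := integral_map (μ := π) hN.measurable.aemeasurable
      (f := fun p => matQuadForm A (locationScale μ δ α β p)) (by rw [hN.map_eq]; exact hL.1)
  rw [hN.map_eq] at e
  -- Averaging over x ↦ -x removes the cross term between location and scale parts.
  have e1 : ∀ p : EuclideanSpace ℝ (Fin n) × EuclideanSpace ℝ (Fin q),
      matQuadForm A (locationScale μ δ α β p) +
        matQuadForm A (locationScale μ δ α β (Prod.map (fun x => -x) id p)) =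
      2 * matQuadForm A (μ + β p.2 • δ) + 2 * matQuadForm A (α p.2 • p.1) := fun p => by
    have h1 : locationScale μ δ α β p = (μ + β p.2 • δ) + (1 : ℝ) • (α p.2 • p.1) := by
      simp only [locationScale]; module
    have h2 : locationScale μ δ α β (Prod.map (fun x => -x) id p) =
        (μ + β p.2 • δ) + (-1 : ℝ) • (α p.2 • p.1) := by
      simp only [locationScale, Prod.map, id]; module
    rw [h1, h2, matQuadForm_add_smul A _ _ 1, matQuadForm_add_smul A _ _ (-1)]
    ring
  have e2 : 2 * ∫ p, matQuadForm A (locationScale μ δ α β p) ∂π =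
      2 * ∫ p, matQuadForm A (μ + β p.2 • δ) ∂π + 2 * ∫ p, matQuadForm A (α p.2 • p.1) ∂π := by
    rw [two_mul]
    nth_rewrite 2 [e]
    rw [← integral_add hL hL']
    simp only [e1]
    rw [integral_add (hm.const_mul 2) (hX.const_mul 2), integral_const_mul, integral_const_mul]
  have e3 : ∫ p, matQuadForm A (μ + β p.2 • δ) ∂π = ∫ z, matQuadForm A (μ + β z • δ) ∂H := by
    rw [hπ, integral_fun_snd (μ := ellipticalLaw S (normalizedGenerator n g)) (ν := H)
      (fun z => matQuadForm A (μ + β z • δ))]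
    simp
  have e4 : ∫ p, matQuadForm A (α p.2 • p.1) ∂π = (∫ z, α z ^ 2 ∂H) *
      ∫ x, matQuadForm A x ∂ellipticalLaw S (normalizedGenerator n g) := by
    rw [mul_comm, ← integral_prod_mul]
    congr 1
    ext1 p
    have := matQuadForm_add_smul A 0 p.1 (α p.2)
    simp only [zero_add, WithLp.ofLp_zero, zero_dotProduct, Matrix.mulVec_zero, dotProduct_zero,
      mul_zero] at this
    rw [this]
    simp [matQuadForm, mul_comm]
  rw [hY.integral_comp (continuous_matQuadForm A)]
  linarith

end IsLSE

/-! ### Necessity: linear and quadratic test functions -/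

section Necessity

variable {n q : ℕ} {Ω₁ Ω₂ : Type*} [MeasurableSpace Ω₁] [MeasurableSpace Ω₂]
  {P₁ : Measure Ω₁} {P₂ : Measure Ω₂}
  {Y₁ : Ω₁ → EuclideanSpace ℝ (Fin n)} {Y₂ : Ω₂ → EuclideanSpace ℝ (Fin n)}

theorem CopOrder.integral_clm_eq [IsProbabilityMeasure P₁] [IsProbabilityMeasure P₂]
    (h : CopOrder P₁ P₂ Y₁ Y₂) (h₁ : MemLp Y₁ 2 P₁)
    (h₂ : MemLp Y₂ 2 P₂) (l : EuclideanSpace ℝ (Fin n) →L[ℝ] ℝ) :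
    ∫ ω, l (Y₁ ω) ∂P₁ = ∫ ω, l (Y₂ ω) ∂P₂ := by
  have key : ∀ l : EuclideanSpace ℝ (Fin n) →L[ℝ] ℝ,
      ∫ ω, l (Y₁ ω) ∂P₁ ≤ ∫ ω, l (Y₂ ω) ∂P₂ := fun l =>
    h l l.contDiff (fun x => by
      rw [hessianMatrix_continuousLinearMap]
      intro v _
      simp)
      (l.integrable_comp (h₁.integrable (by norm_num)))
      (l.integrable_comp (h₂.integrable (by norm_num)))
  refine le_antisymm (key l) ?_
  have := key (-l)
  simp only [_root_.neg_apply, integral_neg] at this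
  linarith

variable {μ₁ μ₂ δ₁ δ₂ : EuclideanSpace ℝ (Fin n)} {S₁ S₂ : Matrix (Fin n) (Fin n) ℝ}
  {ψ g : ℝ → ℝ} {α β : EuclideanSpace ℝ (Fin q) → ℝ}
  {H : Measure (EuclideanSpace ℝ (Fin q))} [IsProbabilityMeasure H]

theorem CopOrder.mean_eq [IsProbabilityMeasure P₁] [IsProbabilityMeasure P₂]
    (h : CopOrder P₁ P₂ Y₁ Y₂) (hY₁ : IsLSE P₁ Y₁ μ₁ S₁ δ₁ ψ g α β H)
    (hY₂ : IsLSE P₂ Y₂ μ₂ S₂ δ₂ ψ g α β H) (h₁ : MemLp Y₁ 2 P₁) (h₂ : MemLp Y₂ 2 P₂) :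
    μ₁ + (∫ z, β z ∂H) • δ₁ = μ₂ + (∫ z, β z ∂H) • δ₂ := by
  ext i
  have := h.integral_clm_eq h₁ h₂ (EuclideanSpace.proj i : EuclideanSpace ℝ (Fin n) →L[ℝ] ℝ)
  rw [hY₁.integral_clm h₁, hY₂.integral_clm h₂] at this
  simpa using this

/-- With equal locations the terms free of S cancel in the inequality for x'Ax, leaving ⟨A, S₁⟩ ≤
⟨A, S₂⟩ times E α² · κ > 0. -/
theorem CopOrder.isCompletelyPositive_sub {μ δ : EuclideanSpace ℝ (Fin n)} (hn : 1 ≤ n)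
    (h : CopOrder P₁ P₂ Y₁ Y₂) (hY₁ : IsLSE P₁ Y₁ μ S₁ δ ψ g α β H)
    (hY₂ : IsLSE P₂ Y₂ μ S₂ δ ψ g α β H) (h₁ : MemLp Y₁ 2 P₁) (h₂ : MemLp Y₂ 2 P₂)
    (hα : ¬ ∀ᵐ z ∂H, α z = 0) : IsCompletelyPositive (S₂ - S₁) := by
  refine isCompletelyPositive_of_dual fun A hA => ?_
  have hle := h (matQuadForm A) (contDiff_matQuadForm A)
    (isCopositive_hessianMatrix_matQuadForm hA) (h₁.integrable_matQuadForm A)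
    (h₂.integrable_matQuadForm A)
  have hh := hY₁.measurable_normalizedGenerator
  have hp0 := hY₁.isProbabilityMeasure_one
  have hm₁ := hY₁.memLp_id h₁ hα
  have hm₂ := hY₂.memLp_id h₂ hα
  have hκ := integral_apply_mul_self_pos hh (memLp_ellipticalLaw_one hh hY₁.posDef hm₁) ⟨0, hn⟩
  have ha := hY₁.integral_scale_sq_pos hn h₁ hα
  rw [hY₁.integral_matQuadForm h₁, hY₂.integral_matQuadForm h₂,
    integral_matQuadForm_ellipticalLaw hh hY₁.posDef hm₁ A ⟨0, hn⟩,
    integral_matQuadForm_ellipticalLaw hh hY₂.posDef hm₂ A ⟨0, hn⟩] at hle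
  have := le_of_mul_le_mul_left (le_of_mul_le_mul_left (le_of_add_le_add_left hle) ha) hκ
  simp only [Matrix.sub_apply, mul_sub, Finset.sum_sub_distrib]
  linarith

theorem CopOrder.loc_eq [IsProbabilityMeasure P₁] [IsProbabilityMeasure P₂]
    {μ : EuclideanSpace ℝ (Fin n)} (h : CopOrder P₁ P₂ Y₁ Y₂)
    (hY₁ : IsLSE P₁ Y₁ μ S₁ δ₁ ψ g α β H) (hY₂ : IsLSE P₂ Y₂ μ S₂ δ₂ ψ g α β H)
    (h₁ : MemLp Y₁ 2 P₁) (h₂ : MemLp Y₂ 2 P₂) (hβ : ¬ ∀ᵐ z ∂H, β z = 0) : δ₁ = δ₂ := by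
  by_contra hne
  -- If δ₁ ≠ δ₂, one of them is nonzero, and that vector forces β to be integrable.
  have hint : Integrable β H := by
    by_cases h0 : δ₁ = 0
    · exact hY₂.integrable_loc h₂ fun h0' => hne (h0.trans h0'.symm)
    · exact hY₁.integrable_loc h₁ h0
  have hb : ∫ z, β z ∂H ≠ 0 := fun h0 => hβ
    ((integral_eq_zero_iff_of_nonneg hY₁.loc_nonneg hint).1 h0)
  exact hne (smul_right_injective _ hb (add_left_cancel (h.mean_eq hY₁ hY₂ h₁ h₂)))

end Necessity

theorem mainTheorem9 {n q : ℕ} (hn : 1 ≤ n)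
    {Ω₁ Ω₂ : Type*} [MeasurableSpace Ω₁] [MeasurableSpace Ω₂]
    (P₁ : Measure Ω₁) [IsProbabilityMeasure P₁] (P₂ : Measure Ω₂) [IsProbabilityMeasure P₂]
    (Y₁ : Ω₁ → EuclideanSpace ℝ (Fin n)) (Y₂ : Ω₂ → EuclideanSpace ℝ (Fin n))
    (μ₁ μ₂ δ₁ δ₂ : EuclideanSpace ℝ (Fin n)) (S₁ S₂ : Matrix (Fin n) (Fin n) ℝ)
    (ψ g : ℝ → ℝ) (α β : EuclideanSpace ℝ (Fin q) → ℝ)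
    (H : Measure (EuclideanSpace ℝ (Fin q))) [IsProbabilityMeasure H]
    (hY₁ : IsLSE P₁ Y₁ μ₁ S₁ δ₁ ψ g α β H) (hY₂ : IsLSE P₂ Y₂ μ₂ S₂ δ₂ ψ g α β H) :
    (μ₁ = μ₂ → δ₁ = δ₂ → IsCompletelyPositive (S₂ - S₁) → CopOrder P₁ P₂ Y₁ Y₂) ∧
    (MemLp Y₁ 2 P₁ → MemLp Y₂ 2 P₂ → ¬ (∀ᵐ z ∂H, α z = 0) →
      (¬ (∀ᵐ z ∂H, β z = 0) → μ₁ = μ₂ →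
        (CopOrder P₁ P₂ Y₁ Y₂ ↔ δ₁ = δ₂ ∧ IsCompletelyPositive (S₂ - S₁))) ∧
      (δ₁ = δ₂ →
        (CopOrder P₁ P₂ Y₁ Y₂ ↔ μ₁ = μ₂ ∧ IsCompletelyPositive (S₂ - S₁)))) := by
  refine ⟨?_, fun h₁ h₂ hα => ⟨fun hβ hμ => ?_, fun hδ => ?_⟩⟩
  · rintro rfl rfl hcp
    exact copOrder_of_isCompletelyPositive hY₁ hY₂ hcp
  · subst hμ
    constructor
    · intro h
      obtain rfl := h.loc_eq hY₁ hY₂ h₁ h₂ hβ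
      exact ⟨rfl, h.isCompletelyPositive_sub hn hY₁ hY₂ h₁ h₂ hα⟩
    · rintro ⟨rfl, hcp⟩
      exact copOrder_of_isCompletelyPositive hY₁ hY₂ hcp
  · subst hδ
    constructor
    · intro h
      -- The term (∫β)δ is the same on both sides, so it cancels even where the integral is the
      -- default value 0.
      obtain rfl := add_right_cancel (h.mean_eq hY₁ hY₂ h₁ h₂)
      exact ⟨rfl, h.isCompletelyPositive_sub hn hY₁ hY₂ h₁ h₂ hα⟩
    · rintro ⟨rfl, hcp⟩
      exact copOrder_of_isCompletelyPositive hY₁ hY₂ hcp
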